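/- Let $n\ge 2$, $\sigma>0$, and let $\phi=(f_1,\dots,f_n)^{\tau}:\mathbb R\to\mathbb R^n$ be measurable. Let $E\subseteq\mathbb R$ be open, and assume that $f_1,\dots,f_n$ are of class $C^n$ on $E$ and that (A3) $f_1,\dots,f_n$ are linearly independent on $E$. Then there is a constant $M>0$, depending only on $\sigma$, $\phi$ and $E$, with the following property. Let $\theta_0\in\mathbb R^n$, let $\theta$ (a random vector in $\mathbb R^n$) and $w_1,w_2,\dots$ (real random variables) be defined on a probability space and satisfy (A1) $(w_t)_{t\ge1}$ is i.i.d. with $w_1\sim N(0,\sigma^2)$; (A2) $\theta\sim N(\theta_0,I_n)$ is independent of $(w_t)_{t\ge 1}$; and let the initial output $y_0$ be a real random variable independent of $(\theta,(w_t)_{t\ge1})$ (for example a constant). Consider the closed-loop system with the least-squares self-tuning regulator: $\hat\theta_0=\theta_0$, $P_0=I_n$ and, for $t\ge0$, with $\phi_t=\phi(y_t)$, $$u_t=-\hat\theta_t^{\tau}\phi_t,\qquad y_{t+1}=\theta^{\tau}\phi_t+u_t+w_{t+1},$$ $$P_{t+1}=P_t-(\sigma^2+\phi_t^{\tau}P_t\phi_t)^{-1}P_t\phi_t\phi_t^{\tau}P_t,\qquad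 \hat\theta_{t+1}=\hat\theta_t+\sigma^{-2}P_{t+1}\phi_t\,(y_{t+1}-u_t-\phi_t^{\tau}\hat\theta_t).$$ Let $\lambda_{\min}(t+1)$ be the minimal eigenvalue of $P_{t+1}^{-1}$ and, for $t\ge0$, let $\sigma_t\ge 0$ be the conditional standard deviation of $y_{t+1}$ given $\mathcal F_t^y=\sigma(y_0,\dots,y_t)$, i.e. $\sigma_t^2$ is the variance of the regular conditional distribution of $y_{t+1}$ given $\mathcal F^y_t$. Then $$\liminf_{t\to\infty}\frac{\lambda_{\min}(t+1)}{t}\;\ge\; M\,\liminf_{t\to\infty}\frac1t\sum_{i=1}^{t}\frac1{\sigma_{i-1}}\qquad\text{almost surely},$$ where the left-hand side may be $+\infty$. -/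

import Mathlib

open MeasureTheory ProbabilityTheory Filter
open scoped Matrix

noncomputable section

namespace LSSTR

/-- The regression vector `φ(x) = (f₁(x), …, fₙ(x))`. -/
def phi {n : ℕ} (f : Fin n → ℝ → ℝ) (x : ℝ) : Fin n → ℝ := fun j => f j x

/-- State of the closed loop at time `t`: the output `y_t`, the least-squares estimate of the
parameter, and the matrix `P_t`. -/
structure State (n : ℕ) where
  /-- the output `y_t` -/
  y : ℝ
  /-- the least-squares estimate of the parameter at time `t` -/
  est : Fin n → ℝ
  /-- the matrix `P_t` -/
  P : Matrix (Fin n) (Fin n) ℝ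

/-- The certainty-equivalence input `u_t = -(estimate)ᵀ φ(y_t)`. -/
def input {n : ℕ} (f : Fin n → ℝ → ℝ) (s : State n) : ℝ :=
  -(s.est ⬝ᵥ phi f s.y)

/-- The output equation `y_{t+1} = θᵀ φ(y_t) + u_t + w_{t+1}`; here `v` is the noise `w_{t+1}`. -/
def output {n : ℕ} (f : Fin n → ℝ → ℝ) (θ : Fin n → ℝ) (s : State n) (v : ℝ) : ℝ :=
  θ ⬝ᵥ phi f s.y + input f s + v

/-- `P_{t+1} = P_t - (σ² + φ_tᵀ P_t φ_t)⁻¹ P_t φ_t φ_tᵀ P_t`. -/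
def nextP {n : ℕ} (f : Fin n → ℝ → ℝ) (σ : ℝ) (s : State n) : Matrix (Fin n) (Fin n) ℝ :=
  s.P - (σ ^ 2 + phi f s.y ⬝ᵥ (s.P *ᵥ phi f s.y))⁻¹ •
    (s.P * Matrix.vecMulVec (phi f s.y) (phi f s.y) * s.P)

/-- The least-squares update of the estimate once the new output `y' = y_{t+1}` is observed:
the old estimate plus `σ⁻² P_{t+1} φ_t (y_{t+1} - u_t - φ_tᵀ (old estimate))`. -/
def nextEst {n : ℕ} (f : Fin n → ℝ → ℝ) (σ : ℝ) (s : State n) (y' : ℝ) : Fin n → ℝ :=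
  s.est + ((σ ^ 2)⁻¹ * (y' - input f s - phi f s.y ⬝ᵥ s.est)) • (nextP f σ s *ᵥ phi f s.y)

/-- One step of the closed loop, with parameter `θ` and new noise value `v = w_{t+1}`. -/
def step {n : ℕ} (f : Fin n → ℝ → ℝ) (σ : ℝ) (θ : Fin n → ℝ) (s : State n) (v : ℝ) : State n where
  y := output f θ s v
  est := nextEst f σ s (output f θ s v)
  P := nextP f σ s

/-- The closed-loop trajectory with initial output `y₀`, initial estimate `θ₀`, `P_0 = I`, true
parameter `θ` and noise `w` (the noise enters through `w 1, w 2, …` only). -/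
def traj {n : ℕ} (f : Fin n → ℝ → ℝ) (σ : ℝ) (θ₀ θ : Fin n → ℝ) (y₀ : ℝ) (w : ℕ → ℝ) :
    ℕ → State n
  | 0 => ⟨y₀, θ₀, 1⟩
  | t + 1 => step f σ θ (traj f σ θ₀ θ y₀ w t) (w (t + 1))

/-- The closed-loop system on a sample space: the parameter, the initial output and the noise are
random, and so is the state at each time. -/
def closedLoop {Ω : Type*} {n : ℕ} (f : Fin n → ℝ → ℝ) (σ : ℝ) (θ₀ : EuclideanSpace ℝ (Fin n))
    (θ : Ω → EuclideanSpace ℝ (Fin n)) (y₀ : Ω → ℝ) (w : ℕ → Ω → ℝ) (t : ℕ) (ω : Ω) : State n :=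
  traj f σ (fun j => θ₀ j) (fun j => θ ω j) (y₀ ω) (fun i => w i ω) t

/-- The minimal eigenvalue of a symmetric real matrix (its real spectrum is the finite set of its
eigenvalues). -/
def lambdaMin {n : ℕ} (A : Matrix (Fin n) (Fin n) ℝ) : ℝ := sInf (spectrum ℝ A)

/-- The conditional standard deviation `σ_t` of `y_{t+1}` given the σ-algebra generated by
`y_0, …, y_t`: the square root of the variance of the regular conditional distribution of `y_{t+1}`
given `(y_0, …, y_t)`. The conditional distribution is used because `y_{t+1}` need not
be integrable, although its conditional law is Gaussian. -/
def condSD {Ω : Type*} [MeasurableSpace Ω] (μ : Measure Ω) [IsFiniteMeasure μ]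
    (y : ℕ → Ω → ℝ) (t : ℕ) (ω : Ω) : ℝ :=
  √(Var[id; condDistrib (y (t + 1)) (fun ω' (i : Fin (t + 1)) => y i ω') μ
    (fun i : Fin (t + 1) => y i ω)])

end LSSTR

end

/-!
The smallest eigenvalue of `P_{t+1}⁻¹` is bounded from below by a law of large numbers for the
normalised Gram matrices of the outputs.

By the Sherman–Morrison identity (`inv_condCov`), `P_{t+1}⁻¹ = I + σ⁻² ∑_{i ≤ t} φ_i φ_iᵀ`.
Replacing `φ φᵀ` by the smaller matrix `φ φᵀ / (1 + |φ|²)`, whose entries are bounded by one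
(`normGram`), gives a lower bound, and only the outputs `y_1, …, y_t` are kept.

The least-squares recursion is the Kalman filter of the closed loop. Given `y_0, …, y_t` the
parameter is Gaussian with mean the current estimate and covariance `P_t`; this is carried along the
recursion by `IsGaussianPosterior.update`, which rests on the independence of the innovation and the
regression residual of the parameter (`map_gaussian_regression`). As the input cancels the predicted
output, `y_{t+1}` is the innovation itself, so that its conditional law is centred Gaussian with
variance `σ_t² = σ² + φ_tᵀ P_t φ_t ≥ σ²` (`ClosedLoopData.condSD_eq`).

For a bounded measurable `g`, the differences between `g (y_{i+1})` and its conditional expectation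
given `y_0, …, y_i` are bounded and orthogonal, hence their averages tend to zero almost surely
(`ClosedLoopData.tendsto_average`). Applied to the entries of the normalised Gram matrix, this
replaces them by their integrals against `N(0, σ_i²)`. The density of `N(0, v)` is at least
`σ / √v` times that of `N(0, σ²)` if `v ≥ σ²` (`smul_gaussianReal_le`), and linear independence of
`f_1, …, f_n` on the open set `E`, where they are continuous, makes the normalised Gram matrix
integrated against `N(0, σ²)` positive definite (`exists_coercivity_const`). Thus the predicted
quadratic form at time `i` is at least `c σ / σ_i` on the unit sphere, with `c` depending on `σ` and
`f` only, and `M = c / σ` works.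
-/

noncomputable section

namespace LSSTR

variable {n : ℕ}

/-! ### Regression of a Gaussian vector on a noisy linear observation -/

lemma inner_eq_dotProduct (x y : EuclideanSpace ℝ (Fin n)) :
    inner ℝ x y = x.ofLp ⬝ᵥ y.ofLp := by
  rw [EuclideanSpace.inner_eq_star_dotProduct, dotProduct_comm]
  simp

/-- The variance `σ² + φᵀ P φ` of the innovation `φᵀ(θ - m) + w` when `θ` has covariance `P` and the
independent noise `w` has variance `σ²`. -/
def innovVar (σ : ℝ) (P : Matrix (Fin n) (Fin n) ℝ) (φ : Fin n → ℝ) : ℝ := σ ^ 2 + φ ⬝ᵥ (P *ᵥ φ)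

/-- The regression coefficient `(σ² + φᵀ P φ)⁻¹ P φ` of the parameter on the innovation. -/
def gain (σ : ℝ) (P : Matrix (Fin n) (Fin n) ℝ) (φ : Fin n → ℝ) : Fin n → ℝ :=
  (innovVar σ P φ)⁻¹ • P *ᵥ φ

/-- The covariance of the parameter given the innovation. -/
def condCov (σ : ℝ) (P : Matrix (Fin n) (Fin n) ℝ) (φ : Fin n → ℝ) : Matrix (Fin n) (Fin n) ℝ :=
  P - (innovVar σ P φ)⁻¹ • (P * Matrix.vecMulVec φ φ * P)

/-- If `θ` is Gaussian and `w` is independent Gaussian noise, then the innovation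
`φᵀ(θ - m) + w` is independent of the residual of `θ` after regression on it. The proof compares
characteristic functions. -/
lemma map_gaussian_regression {σ : ℝ} (hσ : 0 < σ) (m φ : Fin n → ℝ)
    {P : Matrix (Fin n) (Fin n) ℝ} (hP : P.PosSemidef)
    (hP' : (condCov σ P φ).PosSemidef) :
    ((multivariateGaussian (WithLp.toLp 2 m) P).prod
        (gaussianReal 0 (σ ^ 2).toNNReal)).map
      (fun p => (φ ⬝ᵥ (p.1.ofLp - m) + p.2,
        p.1 - (φ ⬝ᵥ (p.1.ofLp - m) + p.2) •
          WithLp.toLp 2 (gain σ P φ)))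
      = (gaussianReal 0 (innovVar σ P φ).toNNReal).prod
          (multivariateGaussian (WithLp.toLp 2 m)
            (condCov σ P φ)) := by
  have hpos : 0 ≤ φ ⬝ᵥ (P *ᵥ φ) := by simpa using hP.dotProduct_mulVec_nonneg φ
  have hs : 0 < σ ^ 2 + φ ⬝ᵥ (P *ᵥ φ) := by positivity
  rw [condCov] at hP' ⊢
  unfold gain innovVar at *
  set s := σ ^ 2 + φ ⬝ᵥ (P *ᵥ φ) with hsdef
  have hsymm : ∀ x y : Fin n → ℝ, x ⬝ᵥ (P *ᵥ y) = y ⬝ᵥ (P *ᵥ x) := by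
    intro x y
    have h : Pᵀ = P := by simpa using hP.isHermitian.eq
    rw [Matrix.dotProduct_mulVec, ← Matrix.mulVec_transpose, h, dotProduct_comm]
  have hg : Measurable (fun p : EuclideanSpace ℝ (Fin n) × ℝ => (φ ⬝ᵥ (p.1.ofLp - m) + p.2,
        p.1 - (φ ⬝ᵥ (p.1.ofLp - m) + p.2) • WithLp.toLp 2 (s⁻¹ • P *ᵥ φ))) := by
    simp only [dotProduct]
    fun_prop
  have : IsProbabilityMeasure (((multivariateGaussian (WithLp.toLp 2 m) P).prod
        (gaussianReal 0 (σ ^ 2).toNNReal)).map (fun p : EuclideanSpace ℝ (Fin n) × ℝ =>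
        (φ ⬝ᵥ (p.1.ofLp - m) + p.2,
        p.1 - (φ ⬝ᵥ (p.1.ofLp - m) + p.2) • WithLp.toLp 2 (s⁻¹ • P *ᵥ φ)))) :=
    Measure.isProbabilityMeasure_map hg.aemeasurable
  rw [← charFun_eq_prod_iff]
  intro t
  obtain ⟨b, x⟩ := t
  set k : ℝ := x.ofLp ⬝ᵥ (s⁻¹ • P *ᵥ φ) with hk
  set c : ℝ := b - k with hc
  -- after collecting terms, the exponent splits into a function of the parameter and one of
  -- the noise
  have key : ∀ p : EuclideanSpace ℝ (Fin n) × ℝ,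
      Complex.exp ((inner ℝ (WithLp.toLp 2 (φ ⬝ᵥ (p.1.ofLp - m) + p.2,
        p.1 - (φ ⬝ᵥ (p.1.ofLp - m) + p.2) • WithLp.toLp 2 (s⁻¹ • P *ᵥ φ)))
          (WithLp.toLp 2 (b, x)) : ℝ) * Complex.I)
      = Complex.exp (-(c * (φ ⬝ᵥ m) : ℝ) * Complex.I) *
        (Complex.exp ((inner ℝ p.1 (x + c • WithLp.toLp 2 φ) : ℝ) * Complex.I) *
          Complex.exp ((inner ℝ p.2 c : ℝ) * Complex.I)) := by
    intro p
    rw [← Complex.exp_add, ← Complex.exp_add]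
    congr 1
    rw [← add_mul, ← add_mul]
    congr 1
    norm_cast
    simp only [WithLp.prod_inner_apply, inner_eq_dotProduct, real_inner_eq_re_inner]
    simp [dotProduct_add, sub_dotProduct, smul_dotProduct, dotProduct_smul, hc, hk,
      dotProduct_comm φ, dotProduct_comm x.ofLp]
    ring
  rw [charFun_apply, Measure.map_map (by fun_prop) hg, integral_map (by fun_prop) (by fun_prop)]
  simp only [Function.comp_apply, key]
  rw [integral_const_mul, integral_prod_mul
    (fun a : EuclideanSpace ℝ (Fin n) =>
      Complex.exp ((inner ℝ a (x + c • WithLp.toLp 2 φ) : ℝ) * Complex.I))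
    (fun w : ℝ => Complex.exp ((inner ℝ w c : ℝ) * Complex.I)),
    ← charFun_apply, ← charFun_apply, charFun_multivariateGaussian hP,
    charFun_multivariateGaussian hP', charFun_gaussianReal, charFun_gaussianReal,
    ← Complex.exp_add, ← Complex.exp_add, ← Complex.exp_add]
  congr 1
  have hk' : x.ofLp ⬝ᵥ (P *ᵥ φ) = s * k := by
    rw [hk, dotProduct_smul, smul_eq_mul, mul_inv_cancel_left₀ hs.ne']
  have hq : (x + c • WithLp.toLp 2 φ).ofLp ⬝ᵥ (P *ᵥ (x + c • WithLp.toLp 2 φ).ofLp)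
      = x.ofLp ⬝ᵥ (P *ᵥ x.ofLp) + 2 * c * (s * k) + c ^ 2 * (s - σ ^ 2) := by
    simp only [WithLp.ofLp_add, WithLp.ofLp_smul, Matrix.mulVec_add,
      Matrix.mulVec_smul, add_dotProduct, dotProduct_add, smul_dotProduct, dotProduct_smul,
      hsymm φ x.ofLp, hk', hsdef, smul_eq_mul]
    ring
  have hq' : x.ofLp ⬝ᵥ ((P - s⁻¹ • (P * Matrix.vecMulVec φ φ * P)) *ᵥ x.ofLp)
      = x.ofLp ⬝ᵥ (P *ᵥ x.ofLp) - s * k ^ 2 := by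
    rw [Matrix.sub_mulVec, dotProduct_sub, Matrix.smul_mulVec, dotProduct_smul,
      ← Matrix.mulVec_mulVec, ← Matrix.mulVec_mulVec, Matrix.vecMulVec_mulVec,
      Matrix.mulVec_smul, dotProduct_smul, hk', hsymm φ, hk']
    simp
    field_simp
  rw [hq, hq']
  have h1 : ((σ ^ 2).toNNReal : ℝ) = σ ^ 2 := Real.coe_toNNReal _ (by positivity)
  have h2 : ((s).toNNReal : ℝ) = s := Real.coe_toNNReal _ hs.le
  simp only [h1, h2, inner_eq_dotProduct, WithLp.ofLp_add, WithLp.ofLp_smul,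
    add_dotProduct, smul_dotProduct]
  rw [Complex.ext_iff]
  constructor
  · simp [← Complex.ofReal_pow]
    rw [hc]; ring
  · simp [← Complex.ofReal_pow]

/-! ### Gaussian posterior laws and their update -/

lemma innovVar_ge {σ : ℝ} {P : Matrix (Fin n) (Fin n) ℝ} (hP : P.PosDef)
    (φ : Fin n → ℝ) : σ ^ 2 ≤ innovVar σ P φ := by
  have : 0 ≤ φ ⬝ᵥ (P *ᵥ φ) := by simpa using hP.posSemidef.dotProduct_mulVec_nonneg φ
  unfold innovVar
  linarith

lemma innovVar_pos {σ : ℝ} (hσ : 0 < σ) {P : Matrix (Fin n) (Fin n) ℝ} (hP : P.PosDef)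
    (φ : Fin n → ℝ) : 0 < innovVar σ P φ :=
  (by positivity : 0 < σ ^ 2).trans_le (innovVar_ge hP φ)

/-- The Sherman–Morrison identity: the update of the covariance adds `σ⁻² φ φᵀ` to its inverse. -/
lemma inv_condCov {σ : ℝ} (hσ : 0 < σ) {P : Matrix (Fin n) (Fin n) ℝ} (hP : P.PosDef)
    (φ : Fin n → ℝ) :
    (condCov σ P φ)⁻¹ = P⁻¹ + (σ ^ 2)⁻¹ • Matrix.vecMulVec φ φ := by
  apply Matrix.inv_eq_left_inv
  have hs := innovVar_pos hσ hP φ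
  have hu : P⁻¹ * P = 1 := Matrix.nonsing_inv_mul P ((Matrix.isUnit_iff_isUnit_det _).1 hP.isUnit)
  have h1 : Matrix.vecMulVec φ φ * P * Matrix.vecMulVec φ φ
      = (innovVar σ P φ - σ ^ 2) • Matrix.vecMulVec φ φ := by
    rw [Matrix.mul_assoc, Matrix.mul_vecMulVec, Matrix.vecMulVec_mul_vecMulVec]
    simp [innovVar]
  rw [condCov, mul_sub, add_mul, hu, Matrix.mul_smul, add_mul, ← Matrix.mul_assoc,
    ← Matrix.mul_assoc, hu, Matrix.one_mul, Matrix.smul_mul, Matrix.smul_mul, ← Matrix.mul_assoc,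
    ← Matrix.mul_assoc, h1, Matrix.smul_mul, smul_add, smul_smul, smul_smul,
    add_sub_assoc, sub_eq_zero.2, add_zero]
  rw [← add_smul]
  congr 1
  field_simp
  ring

lemma posDef_condCov {σ : ℝ} (hσ : 0 < σ) {P : Matrix (Fin n) (Fin n) ℝ} (hP : P.PosDef)
    (φ : Fin n → ℝ) : (condCov σ P φ).PosDef := by
  have h : (P⁻¹ + (σ ^ 2)⁻¹ • Matrix.vecMulVec φ φ).PosDef := by
    refine hP.inv.add_posSemidef ?_
    have := (Matrix.posSemidef_vecMulVec_self_star φ).smul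
      (show 0 ≤ (σ ^ 2)⁻¹ by positivity)
    simpa using this
  rw [← inv_condCov hσ hP] at h
  exact Matrix.posDef_inv_iff.1 h

lemma multivariateGaussian_eq_map_add (m : EuclideanSpace ℝ (Fin n))
    (P : Matrix (Fin n) (Fin n) ℝ) :
    multivariateGaussian m P = (multivariateGaussian 0 P).map (fun x => m + x) := by
  rw [multivariateGaussian, multivariateGaussian, Measure.map_map (by fun_prop) (by fun_prop)]
  congr 1
  ext1 x
  simp

/-- The Bayes update in integrated form: sampling the parameter and the noise is the same as
sampling the innovation from its marginal law and then the parameter from its updated Gaussian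
law. -/
lemma lintegral_gaussian_bayes {σ : ℝ} (hσ : 0 < σ) (m φ : Fin n → ℝ)
    {P : Matrix (Fin n) (Fin n) ℝ} (hP : P.PosDef)
    {F : ℝ × EuclideanSpace ℝ (Fin n) → ENNReal} (hF : Measurable F) :
    ∫⁻ ϑ, ∫⁻ v, F (φ ⬝ᵥ (ϑ.ofLp - m) + v, ϑ) ∂gaussianReal 0 (σ ^ 2).toNNReal
        ∂multivariateGaussian (WithLp.toLp 2 m) P
      = ∫⁻ z, ∫⁻ ϑ, F (z, ϑ) ∂multivariateGaussian (WithLp.toLp 2 (m + z • gain σ P φ))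
          (condCov σ P φ) ∂gaussianReal 0 (innovVar σ P φ).toNNReal := by
  have hinner : ∀ z, ∫⁻ ϑ, F (z, ϑ) ∂multivariateGaussian (WithLp.toLp 2 (m + z • gain σ P φ))
      (condCov σ P φ) = ∫⁻ r, F (z, r + z • WithLp.toLp 2 (gain σ P φ))
        ∂multivariateGaussian (WithLp.toLp 2 m) (condCov σ P φ) := by
    intro z
    rw [multivariateGaussian_eq_map_add, multivariateGaussian_eq_map_add (WithLp.toLp 2 m),
      lintegral_map (by fun_prop) (by fun_prop), lintegral_map (by fun_prop) (by fun_prop)]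
    refine lintegral_congr fun x => ?_
    congr 2
    ext i
    simp
    ring
  have hm : Measurable fun p : EuclideanSpace ℝ (Fin n) × ℝ => φ ⬝ᵥ (p.1.ofLp - m) + p.2 := by
    simp only [dotProduct]
    fun_prop
  simp_rw [hinner]
  rw [← lintegral_prod (fun p : EuclideanSpace ℝ (Fin n) × ℝ => F (φ ⬝ᵥ (p.1.ofLp - m) + p.2, p.1))
      (by fun_prop),
    ← lintegral_prod (fun p : ℝ × EuclideanSpace ℝ (Fin n) =>
      F (p.1, p.2 + p.1 • WithLp.toLp 2 (gain σ P φ))) (by fun_prop),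
    ← map_gaussian_regression hσ m φ hP.posSemidef (posDef_condCov hσ hP φ).posSemidef,
    lintegral_map (by fun_prop) (by fun_prop)]
  simp

/-- The pushforward of a Markov kernel by a map that may also depend on the source is measurable. -/
lemma measurable_map_of_measurable {A B C : Type*} [MeasurableSpace A] [MeasurableSpace B]
    [MeasurableSpace C] {κ : A → Measure B} (hκ : Measurable κ)
    (hκ1 : ∀ a, IsProbabilityMeasure (κ a))
    {g : A × B → C} (hg : Measurable g) : Measurable fun a => (κ a).map (fun b => g (a, b)) := by
  let K : Kernel A B := ⟨κ, hκ⟩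
  have : IsMarkovKernel K := ⟨hκ1⟩
  have h := (Kernel.map (Kernel.id ×ₖ K) g).measurable
  convert h using 2 with a
  rw [Kernel.map_apply _ hg, Kernel.prod_apply, Kernel.id_apply, Measure.dirac_prod,
    Measure.map_map hg (by fun_prop)]
  rfl

lemma measurable_lintegral_of_measurable {A B : Type*} [MeasurableSpace A] [MeasurableSpace B]
    {κ : A → Measure B} (hκ : Measurable κ)
    (hκ1 : ∀ a, IsProbabilityMeasure (κ a))
    {F : A × B → ENNReal} (hF : Measurable F) : Measurable fun a => ∫⁻ b, F (a, b) ∂κ a := by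
  let K : Kernel A B := ⟨κ, hκ⟩
  have : IsMarkovKernel K := ⟨hκ1⟩
  exact hF.lintegral_kernel_prod_right' (κ := K)

lemma measurable_prod_const {A B C : Type*} [MeasurableSpace A] [MeasurableSpace B]
    [MeasurableSpace C] {κ : A → Measure B} (hκ : Measurable κ)
    (hκ1 : ∀ a, IsProbabilityMeasure (κ a))
    (ν : Measure C) [IsProbabilityMeasure ν] : Measurable fun a => (κ a).prod ν := by
  let K : Kernel A B := ⟨κ, hκ⟩
  have : IsMarkovKernel K := ⟨hκ1⟩
  have h := (K ×ₖ Kernel.const A ν).measurable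
  convert h using 2 with a
  rw [Kernel.prod_apply, Kernel.const_apply]
  rfl

lemma measurable_gaussianReal_var {A : Type*} [MeasurableSpace A] {v : A → ℝ} (hv : Measurable v) :
    Measurable fun a => gaussianReal 0 (v a).toNNReal := by
  have h := measurable_map_of_measurable (κ := fun _ : A => gaussianReal 0 1) measurable_const
    (fun _ => inferInstance) (g := fun p : A × ℝ => √(v p.1) * p.2) (by fun_prop)
  convert h using 2 with a
  dsimp only
  rw [gaussianReal_map_const_mul]
  congr 1
  · simp
  · ext
    rcases le_total 0 (v a) with h | h
    · simp [h]
    · simp [Real.sqrt_eq_zero_of_nonpos h, Real.toNNReal_of_nonpos h]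

lemma measurable_multivariateGaussian_mean {A : Type*} [MeasurableSpace A]
    {m : A → Fin n → ℝ} (hm : Measurable m) {P : A → Matrix (Fin n) (Fin n) ℝ}
    (hP : Measurable fun a => multivariateGaussian (0 : EuclideanSpace ℝ (Fin n)) (P a)) :
    Measurable fun a => multivariateGaussian (WithLp.toLp 2 (m a)) (P a) := by
  have h := measurable_map_of_measurable hP (fun _ => inferInstance)
    (g := fun p : A × EuclideanSpace ℝ (Fin n) => WithLp.toLp 2 (m p.1) + p.2) (by fun_prop)
  convert h using 2 with a
  rw [multivariateGaussian_eq_map_add]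

/-- Measurable dependence of a centred Gaussian law on its covariance is inherited by the updated
covariance, since the updated law is that of the regression residual. -/
lemma measurable_multivariateGaussian_condCov {A : Type*} [MeasurableSpace A] {σ : ℝ} (hσ : 0 < σ)
    {φ : A → Fin n → ℝ} (hφ : Measurable φ) {P : A → Matrix (Fin n) (Fin n) ℝ}
    (hPd : ∀ a, (P a).PosDef) (hPm : ∀ i j, Measurable fun a => P a i j)
    (hP : Measurable fun a => multivariateGaussian (0 : EuclideanSpace ℝ (Fin n)) (P a)) :
    Measurable fun a =>
      multivariateGaussian (0 : EuclideanSpace ℝ (Fin n)) (condCov σ (P a) (φ a)) := by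
  have hφ' : ∀ i, Measurable fun a => φ a i := fun i => by fun_prop
  have hmv : ∀ i, Measurable fun a => (P a *ᵥ φ a) i := by
    intro i
    simp only [Matrix.mulVec, dotProduct]
    fun_prop
  have hs : Measurable fun a => innovVar σ (P a) (φ a) := by
    simp only [innovVar, dotProduct]
    fun_prop
  have hgain : Measurable fun a => gain σ (P a) (φ a) := by
    refine measurable_pi_lambda _ fun i => ?_
    simp only [gain, Pi.smul_apply, smul_eq_mul]
    fun_prop
  have hgain' : Measurable fun p : A × (EuclideanSpace ℝ (Fin n) × ℝ) =>
      gain σ (P p.1) (φ p.1) := hgain.comp measurable_fst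
  have h := measurable_map_of_measurable
    (measurable_prod_const hP (fun _ => inferInstance) (gaussianReal 0 (σ ^ 2).toNNReal))
    (fun _ => inferInstance)
    (g := fun p : A × (EuclideanSpace ℝ (Fin n) × ℝ) =>
      p.2.1 - (φ p.1 ⬝ᵥ (p.2.1.ofLp - 0) + p.2.2) • WithLp.toLp 2 (gain σ (P p.1) (φ p.1)))
      (by simp only [dotProduct, sub_zero]; fun_prop)
  convert h using 2 with a
  have h1 := congrArg Measure.snd (map_gaussian_regression hσ 0 (φ a) (hPd a).posSemidef
    (posDef_condCov hσ (hPd a) (φ a)).posSemidef)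
  rw [Measure.snd_prod, Measure.snd, Measure.map_map (by fun_prop)
    (by simp only [dotProduct, sub_zero]; fun_prop)] at h1
  rw [WithLp.toLp_zero] at h1
  exact h1.symm

/-- Given the observation `Z`, the law of `Θ` is Gaussian with mean `m Z` and covariance `P Z`.
The conditional law is expressed by an identity of integrals of nonnegative functions. The
measurability of `a ↦ N(0, P a)` is part of the structure, so that `N(m Z, P Z)` is a kernel. -/
structure IsGaussianPosterior {Ω A : Type*} [MeasurableSpace Ω] [MeasurableSpace A] (μ : Measure Ω)
    (Z : Ω → A) (Θ : Ω → EuclideanSpace ℝ (Fin n)) (m : A → Fin n → ℝ)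
    (P : A → Matrix (Fin n) (Fin n) ℝ) : Prop where
  measurable_mean : Measurable m
  measurable_cov : ∀ i j, Measurable fun a => P a i j
  posDef : ∀ a, (P a).PosDef
  measurable_gaussian :
    Measurable fun a => multivariateGaussian (0 : EuclideanSpace ℝ (Fin n)) (P a)
  lintegral_eq : ∀ F : A × EuclideanSpace ℝ (Fin n) → ENNReal, Measurable F →
    ∫⁻ ω, F (Z ω, Θ ω) ∂μ =
      ∫⁻ ω, ∫⁻ ϑ, F (Z ω, ϑ) ∂multivariateGaussian (WithLp.toLp 2 (m (Z ω))) (P (Z ω)) ∂μ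

namespace IsGaussianPosterior

variable {Ω A : Type*} [MeasurableSpace Ω] [MeasurableSpace A] {μ : Measure Ω}
  {Z : Ω → A} {Θ : Ω → EuclideanSpace ℝ (Fin n)} {m : A → Fin n → ℝ}
  {P : A → Matrix (Fin n) (Fin n) ℝ}

lemma measurable_innovVar (h : IsGaussianPosterior μ Z Θ m P) {φ : A → Fin n → ℝ}
    (hφ : Measurable φ) (σ : ℝ) : Measurable fun a => innovVar σ (P a) (φ a) := by
  have hφ' : ∀ i, Measurable fun a => φ a i := fun i => by fun_prop
  have := h.measurable_cov
  simp only [innovVar, dotProduct, Matrix.mulVec]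
  fun_prop

lemma measurable_gain (h : IsGaussianPosterior μ Z Θ m P) {φ : A → Fin n → ℝ}
    (hφ : Measurable φ) (σ : ℝ) : Measurable fun a => gain σ (P a) (φ a) := by
  have hφ' : ∀ i, Measurable fun a => φ a i := fun i => by fun_prop
  have := h.measurable_cov
  have := h.measurable_innovVar hφ σ
  refine measurable_pi_lambda _ fun i => ?_
  simp only [gain, Pi.smul_apply, smul_eq_mul, dotProduct, Matrix.mulVec]
  fun_prop

lemma measurable_condCov (h : IsGaussianPosterior μ Z Θ m P) {φ : A → Fin n → ℝ}
    (hφ : Measurable φ) (σ : ℝ) (i j : Fin n) :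
    Measurable fun a => condCov σ (P a) (φ a) i j := by
  have hφ' : ∀ i, Measurable fun a => φ a i := fun i => by fun_prop
  have := h.measurable_cov
  have := h.measurable_innovVar hφ σ
  simp only [condCov, Matrix.sub_apply, Matrix.smul_apply, Matrix.mul_apply, Matrix.vecMulVec_apply,
    smul_eq_mul]
  fun_prop

/-- Transport of the posterior along an invertible re-encoding of the observation. -/
lemma comp {B : Type*} [MeasurableSpace B] (h : IsGaussianPosterior μ Z Θ m P) {e : A → B}
    {d : B → A} (he : Measurable e) (hd : Measurable d) (hde : ∀ a, d (e a) = a) :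
    IsGaussianPosterior μ (fun ω => e (Z ω)) Θ (fun b => m (d b)) (fun b => P (d b)) where
  measurable_mean := h.measurable_mean.comp hd
  measurable_cov i j := (h.measurable_cov i j).comp hd
  posDef b := h.posDef _
  measurable_gaussian := h.measurable_gaussian.comp hd
  lintegral_eq F hF := by
    simp only [hde]
    exact h.lintegral_eq (fun p => F (e p.1, p.2)) (by fun_prop)

variable [IsProbabilityMeasure μ]

/-- The joint law of the past, the new innovation and the parameter. -/
lemma lintegral_innovation (h : IsGaussianPosterior μ Z Θ m P) {σ : ℝ} (hσ : 0 < σ)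
    {φ : A → Fin n → ℝ} (hφ : Measurable φ) (hZ : Measurable Z) (hΘ : Measurable Θ) {W : Ω → ℝ}
    (hW : HasLaw W (gaussianReal 0 (σ ^ 2).toNNReal) μ)
    (hind : IndepFun (fun ω => (Z ω, Θ ω)) W μ)
    {F : A × ℝ × EuclideanSpace ℝ (Fin n) → ENNReal} (hF : Measurable F) :
    ∫⁻ ω, F (Z ω, φ (Z ω) ⬝ᵥ ((Θ ω).ofLp - m (Z ω)) + W ω, Θ ω) ∂μ =
      ∫⁻ ω, ∫⁻ z, ∫⁻ ϑ, F (Z ω, z, ϑ)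
        ∂multivariateGaussian (WithLp.toLp 2 (m (Z ω) + z • gain σ (P (Z ω)) (φ (Z ω))))
          (condCov σ (P (Z ω)) (φ (Z ω)))
        ∂gaussianReal 0 (innovVar σ (P (Z ω)) (φ (Z ω))).toNNReal ∂μ := by
  have hm := h.measurable_mean
  have hm' : ∀ i, Measurable fun a => m a i := fun i => by fun_prop
  have hφ' : ∀ i, Measurable fun a => φ a i := fun i => by fun_prop
  have hG : Measurable fun p : (A × EuclideanSpace ℝ (Fin n)) × ℝ =>
      F (p.1.1, φ p.1.1 ⬝ᵥ (p.1.2.ofLp - m p.1.1) + p.2, p.1.2) := by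
    refine hF.comp (Measurable.prodMk (by fun_prop) (Measurable.prodMk ?_ (by fun_prop)))
    simp only [dotProduct, Pi.sub_apply]
    fun_prop
  have hlaw := (indepFun_iff_map_prod_eq_prod_map_map (hZ.prodMk hΘ).aemeasurable
    hW.aemeasurable).1 hind
  rw [hW.map_eq] at hlaw
  calc ∫⁻ ω, F (Z ω, φ (Z ω) ⬝ᵥ ((Θ ω).ofLp - m (Z ω)) + W ω, Θ ω) ∂μ
      = ∫⁻ p, F (p.1.1, φ p.1.1 ⬝ᵥ (p.1.2.ofLp - m p.1.1) + p.2, p.1.2)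
          ∂(μ.map fun ω => ((Z ω, Θ ω), W ω)) := by
        rw [lintegral_map' hG.aemeasurable ((hZ.prodMk hΘ).aemeasurable.prodMk hW.aemeasurable)]
    _ = ∫⁻ ω, ∫⁻ v, F (Z ω, φ (Z ω) ⬝ᵥ ((Θ ω).ofLp - m (Z ω)) + v, Θ ω)
          ∂gaussianReal 0 (σ ^ 2).toNNReal ∂μ := by
        rw [hlaw, lintegral_prod _ hG.aemeasurable, lintegral_map hG.lintegral_prod_right'
          (hZ.prodMk hΘ)]
    _ = ∫⁻ ω, ∫⁻ ϑ, ∫⁻ v, F (Z ω, φ (Z ω) ⬝ᵥ (ϑ.ofLp - m (Z ω)) + v, ϑ)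
          ∂gaussianReal 0 (σ ^ 2).toNNReal
          ∂multivariateGaussian (WithLp.toLp 2 (m (Z ω))) (P (Z ω)) ∂μ :=
        h.lintegral_eq _ hG.lintegral_prod_right'
    _ = _ := by
        refine lintegral_congr fun ω => ?_
        exact lintegral_gaussian_bayes hσ (m (Z ω)) (φ (Z ω)) (h.posDef _)
          (F := fun p => F (Z ω, p)) (by fun_prop)

/-- The predictive law: given the past, the innovation is centred Gaussian with variance
`innovVar`. -/
lemma lintegral_predictive (h : IsGaussianPosterior μ Z Θ m P) {σ : ℝ} (hσ : 0 < σ)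
    {φ : A → Fin n → ℝ} (hφ : Measurable φ) (hZ : Measurable Z) (hΘ : Measurable Θ) {W : Ω → ℝ}
    (hW : HasLaw W (gaussianReal 0 (σ ^ 2).toNNReal) μ)
    (hind : IndepFun (fun ω => (Z ω, Θ ω)) W μ)
    {F : A × ℝ → ENNReal} (hF : Measurable F) :
    ∫⁻ ω, F (Z ω, φ (Z ω) ⬝ᵥ ((Θ ω).ofLp - m (Z ω)) + W ω) ∂μ =
      ∫⁻ ω, ∫⁻ z, F (Z ω, z)
        ∂gaussianReal 0 (innovVar σ (P (Z ω)) (φ (Z ω))).toNNReal ∂μ := by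
  rw [h.lintegral_innovation hσ hφ hZ hΘ hW hind (F := fun p => F (p.1, p.2.1)) (by fun_prop)]
  simp

/-- One step of the Kalman filter: observing the innovation updates the Gaussian posterior. -/
lemma update (h : IsGaussianPosterior μ Z Θ m P) {σ : ℝ} (hσ : 0 < σ)
    {φ : A → Fin n → ℝ} (hφ : Measurable φ) (hZ : Measurable Z) (hΘ : Measurable Θ) {W : Ω → ℝ}
    (hW : HasLaw W (gaussianReal 0 (σ ^ 2).toNNReal) μ)
    (hind : IndepFun (fun ω => (Z ω, Θ ω)) W μ) :
    IsGaussianPosterior μ (fun ω => (Z ω, φ (Z ω) ⬝ᵥ ((Θ ω).ofLp - m (Z ω)) + W ω)) Θ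
      (fun a : A × ℝ => m a.1 + a.2 • gain σ (P a.1) (φ a.1))
      (fun a : A × ℝ => condCov σ (P a.1) (φ a.1)) where
  measurable_mean := (h.measurable_mean.comp measurable_fst).add
    (measurable_snd.smul ((h.measurable_gain hφ σ).comp measurable_fst))
  measurable_cov i j := (h.measurable_condCov hφ σ i j).comp measurable_fst
  posDef a := posDef_condCov hσ (h.posDef _) _
  measurable_gaussian := (measurable_multivariateGaussian_condCov hσ hφ h.posDef h.measurable_cov
      h.measurable_gaussian).comp measurable_fst
  lintegral_eq F hF := by
    have hκ : Measurable fun a : A × ℝ =>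
        multivariateGaussian (WithLp.toLp 2 (m a.1 + a.2 • gain σ (P a.1) (φ a.1)))
          (condCov σ (P a.1) (φ a.1)) :=
      measurable_multivariateGaussian_mean ((h.measurable_mean.comp measurable_fst).add
        (measurable_snd.smul ((h.measurable_gain hφ σ).comp measurable_fst)))
        ((measurable_multivariateGaussian_condCov hσ hφ h.posDef h.measurable_cov
          h.measurable_gaussian).comp measurable_fst)
    have hH := measurable_lintegral_of_measurable hκ (fun _ => inferInstance) hF
    have h1 := h.lintegral_innovation hσ hφ hZ hΘ hW hind (F := fun p => F ((p.1, p.2.1), p.2.2))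
      (by fun_prop)
    have h2 := h.lintegral_predictive hσ hφ hZ hΘ hW hind hH
    exact h1.trans h2.symm

end IsGaussianPosterior

/-! ### The closed loop as a Kalman filter -/

/-- The state of the closed loop at time `t` as a function of the outputs `y_0, …, y_t`: the
regulator observes the outputs only. -/
def observer (f : Fin n → ℝ → ℝ) (σ : ℝ) (θ₀ : Fin n → ℝ) : (t : ℕ) → (Fin (t + 1) → ℝ) → State n
  | 0, a => ⟨a 0, θ₀, 1⟩
  | t + 1, a =>
    ⟨a (Fin.last (t + 1)), nextEst f σ (observer f σ θ₀ t (Fin.init a)) (a (Fin.last (t + 1))),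
      nextP f σ (observer f σ θ₀ t (Fin.init a))⟩

lemma observer_y (f : Fin n → ℝ → ℝ) (σ : ℝ) (θ₀ : Fin n → ℝ) (t : ℕ) (a : Fin (t + 1) → ℝ) :
    (observer f σ θ₀ t a).y = a (Fin.last t) := by
  cases t <;> rfl

lemma traj_eq_observer (f : Fin n → ℝ → ℝ) (σ : ℝ) (θ₀ θ : Fin n → ℝ) (y₀ : ℝ) (w : ℕ → ℝ) (t : ℕ) :
    traj f σ θ₀ θ y₀ w t =
      observer f σ θ₀ t (fun i : Fin (t + 1) => (traj f σ θ₀ θ y₀ w i).y) := by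
  induction t with
  | zero => rfl
  | succ t ih =>
    rw [observer]
    have : (Fin.init fun i : Fin (t + 1 + 1) => (traj f σ θ₀ θ y₀ w i).y)
        = fun i : Fin (t + 1) => (traj f σ θ₀ θ y₀ w i).y := by
      ext i
      simp [Fin.init]
    rw [this, ← ih]
    rfl

lemma output_eq (f : Fin n → ℝ → ℝ) (θ : Fin n → ℝ) (s : State n) (v : ℝ) :
    output f θ s v = phi f s.y ⬝ᵥ (θ - s.est) + v := by
  rw [output, input, dotProduct_sub, dotProduct_comm θ, dotProduct_comm s.est]
  ring

lemma nextP_eq (f : Fin n → ℝ → ℝ) (σ : ℝ) (s : State n) :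
    nextP f σ s = condCov σ s.P (phi f s.y) := rfl

/-- The least-squares update is the Kalman update: the prediction error is the new output itself,
because the input cancels the predicted output. -/
lemma nextEst_eq (f : Fin n → ℝ → ℝ) {σ : ℝ} (hσ : 0 < σ) {s : State n} (hs : s.P.PosDef) (z : ℝ) :
    nextEst f σ s z = s.est + z • gain σ s.P (phi f s.y) := by
  have hp := innovVar_pos hσ hs (phi f s.y)
  have h1 : nextP f σ s *ᵥ phi f s.y = σ ^ 2 • gain σ s.P (phi f s.y) := by
    rw [nextP_eq, condCov, gain, Matrix.sub_mulVec, Matrix.smul_mulVec, ← Matrix.mulVec_mulVec,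
      ← Matrix.mulVec_mulVec, Matrix.vecMulVec_mulVec, Matrix.mulVec_smul]
    have h2 : phi f s.y ⬝ᵥ s.P *ᵥ phi f s.y = innovVar σ s.P (phi f s.y) - σ ^ 2 := by
      simp [innovVar]
    rw [h2]
    ext i
    simp
    field_simp
    ring
  rw [nextEst, h1, input, dotProduct_comm (phi f s.y), smul_smul]
  congr 2
  field_simp
  ring

lemma measurable_phi {f : Fin n → ℝ → ℝ} (hf : ∀ j, Measurable (f j)) : Measurable (phi f) :=
  measurable_pi_lambda _ hf

section Independence

variable {Ω : Type*} [MeasurableSpace Ω] {μ : Measure Ω} [IsProbabilityMeasure μ]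

/-- If `X` is independent of the pair `(Y, Z)` and `Y` is independent of `Z`, then `(X, Y)` is
independent of `Z`. -/
lemma indepFun_prodMk_left_of_indepFun {A B C : Type*} [MeasurableSpace A]
    [MeasurableSpace B] [MeasurableSpace C]
    {X : Ω → A} {Y : Ω → B} {Z : Ω → C} (hX : Measurable X) (hY : Measurable Y) (hZ : Measurable Z)
    (h : IndepFun X (fun ω => (Y ω, Z ω)) μ) (h' : IndepFun Y Z μ) :
    IndepFun (fun ω => (X ω, Y ω)) Z μ := by
  have h1 := (indepFun_iff_map_prod_eq_prod_map_map hX.aemeasurable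
    (hY.prodMk hZ).aemeasurable).1 h
  rw [(indepFun_iff_map_prod_eq_prod_map_map hY.aemeasurable hZ.aemeasurable).1 h'] at h1
  have hXY : IndepFun X Y μ := h.comp measurable_id measurable_fst
  rw [indepFun_iff_map_prod_eq_prod_map_map (hX.prodMk hY).aemeasurable hZ.aemeasurable,
    (indepFun_iff_map_prod_eq_prod_map_map hX.aemeasurable hY.aemeasurable).1 hXY]
  have := Measure.isProbabilityMeasure_map (μ := μ) hX.aemeasurable
  have := Measure.isProbabilityMeasure_map (μ := μ) hY.aemeasurable
  have := Measure.isProbabilityMeasure_map (μ := μ) hZ.aemeasurable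
  have h2 := Measure.prodAssoc_prod (μ := μ.map X) (ν := μ.map Y) (τ := μ.map Z)
  rw [← h1] at h2
  have h3 := congrArg (Measure.map MeasurableEquiv.prodAssoc.symm) h2
  rw [MeasurableEquiv.map_symm_map] at h3
  rw [h3, Measure.map_map (by fun_prop) (by fun_prop)]
  rfl

/-- For mutually independent noise, the next value is independent of all later ones. -/
lemma indepFun_future {w : ℕ → Ω → ℝ} (hw : ∀ t, Measurable (w t))
    (hind : iIndepFun (fun t => w (t + 1)) μ) (t : ℕ) :
    IndepFun (w (t + 1)) (fun ω k => w (t + 1 + 1 + k) ω) μ := by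
  refine IndepFun.indepFun_process (hw _) (fun k => hw _) fun I => ?_
  have h := hind.indepFun_finset {t} (I.map ⟨fun k => t + 1 + k, add_right_injective _⟩)
    (by simp; intros; omega) (fun i => hw _)
  refine h.comp (φ := fun a : ({t} : Finset ℕ) → ℝ => a ⟨t, by simp⟩)
    (ψ := fun (a : (I.map ⟨fun k => t + 1 + k, add_right_injective _⟩ : Finset ℕ) → ℝ) (k : I) =>
      a ⟨t + 1 + k, by simp⟩) (by fun_prop) (by fun_prop) |>.congr ?_ ?_
  · rfl
  · refine Eventually.of_forall fun ω => ?_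
    ext k
    simp only [Function.comp_apply]
    congr 1
    ring_nf

end Independence

/-- The standing assumptions on the probability space: Gaussian noise, Gaussian prior, and
independence of noise, parameter and initial output. -/
structure ClosedLoopData {Ω : Type*} [MeasurableSpace Ω] (μ : Measure Ω) (σ : ℝ)
    (w : ℕ → Ω → ℝ) (θ₀ : EuclideanSpace ℝ (Fin n)) (θ : Ω → EuclideanSpace ℝ (Fin n))
    (y₀ : Ω → ℝ) : Prop where
  measurable_noise : ∀ t, Measurable (w t)
  measurable_param : Measurable θ
  measurable_init : Measurable y₀
  iIndepFun_noise : iIndepFun (fun t => w (t + 1)) μ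
  hasLaw_noise : ∀ t, HasLaw (w (t + 1)) (gaussianReal 0 (σ ^ 2).toNNReal) μ
  hasLaw_param : HasLaw θ (multivariateGaussian θ₀ 1) μ
  indepFun_param : IndepFun θ (fun ω t => w (t + 1) ω) μ
  indepFun_init : IndepFun y₀ (fun ω => (θ ω, fun t => w (t + 1) ω)) μ

/-- The outputs `y_0, …, y_t` of the closed loop. -/
def outputs {Ω : Type*} (f : Fin n → ℝ → ℝ) (σ : ℝ) (θ₀ : EuclideanSpace ℝ (Fin n))
    (θ : Ω → EuclideanSpace ℝ (Fin n)) (y₀ : Ω → ℝ) (w : ℕ → Ω → ℝ) (t : ℕ) (ω : Ω) :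
    Fin (t + 1) → ℝ :=
  fun i => (closedLoop f σ θ₀ θ y₀ w i ω).y

section ClosedLoop

variable {Ω : Type*} {f : Fin n → ℝ → ℝ} {σ : ℝ} {w : ℕ → Ω → ℝ} {θ₀ : EuclideanSpace ℝ (Fin n)}
  {θ : Ω → EuclideanSpace ℝ (Fin n)} {y₀ : Ω → ℝ}

lemma closedLoop_eq_observer (t : ℕ) (ω : Ω) :
    closedLoop f σ θ₀ θ y₀ w t ω = observer f σ θ₀.ofLp t (outputs f σ θ₀ θ y₀ w t ω) :=
  traj_eq_observer _ _ _ _ _ _ _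

lemma closedLoop_succ_y (t : ℕ) (ω : Ω) :
    (closedLoop f σ θ₀ θ y₀ w (t + 1) ω).y =
      phi f (outputs f σ θ₀ θ y₀ w t ω (Fin.last t)) ⬝ᵥ
        ((θ ω).ofLp - (observer f σ θ₀.ofLp t (outputs f σ θ₀ θ y₀ w t ω)).est) + w (t + 1) ω := by
  have h : (closedLoop f σ θ₀ θ y₀ w (t + 1) ω).y =
    output f (fun j => θ ω j) (closedLoop f σ θ₀ θ y₀ w t ω) (w (t + 1) ω) := rfl
  rw [h, output_eq, closedLoop_eq_observer, observer_y]

lemma outputs_succ (t : ℕ) (ω : Ω) :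
    outputs f σ θ₀ θ y₀ w (t + 1) ω =
      Fin.snoc (α := fun _ => ℝ) (outputs f σ θ₀ θ y₀ w t ω)
        (closedLoop f σ θ₀ θ y₀ w (t + 1) ω).y := by
  rw [← Fin.snoc_init_self (outputs f σ θ₀ θ y₀ w (t + 1) ω)]
  rfl

lemma measurable_snoc (t : ℕ) : Measurable fun p : (Fin t → ℝ) × ℝ =>
    (Fin.snoc (α := fun _ => ℝ) p.1 p.2 : Fin (t + 1) → ℝ) := by
  refine measurable_pi_lambda _ fun i => ?_
  refine Fin.lastCases ?_ (fun j => ?_) i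
  · simpa using measurable_snd
  · simp only [Fin.snoc_castSucc]
    fun_prop

variable [MeasurableSpace Ω] {μ : Measure Ω} [IsProbabilityMeasure μ]

/-- The past of the closed loop is independent of the future noise, and the posterior law of the
parameter given the outputs is Gaussian with the mean and covariance computed by the least-squares
recursion. -/
lemma ClosedLoopData.posterior (h : ClosedLoopData μ σ w θ₀ θ y₀) (hf : ∀ j, Measurable (f j))
    (hσ : 0 < σ) (t : ℕ) :
    Measurable (outputs f σ θ₀ θ y₀ w t) ∧
    IndepFun (fun ω => (outputs f σ θ₀ θ y₀ w t ω, θ ω)) (fun ω k => w (t + 1 + k) ω) μ ∧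
    IsGaussianPosterior μ (outputs f σ θ₀ θ y₀ w t) θ
      (fun a => (observer f σ θ₀.ofLp t a).est) (fun a => (observer f σ θ₀.ofLp t a).P) := by
  have hphi := measurable_phi hf
  have hw := h.measurable_noise
  have hθ := h.measurable_param
  have hy := h.measurable_init
  induction t with
  | zero =>
    have hind0 : IndepFun (fun ω => (y₀ ω, θ ω)) (fun ω k => w (0 + 1 + k) ω) μ := by
      simp only [zero_add, add_comm 1]
      exact indepFun_prodMk_left_of_indepFun hy hθ (by fun_prop) h.indepFun_init h.indepFun_param
    refine ⟨measurable_pi_lambda _ fun i => ?_, ?_, ?_⟩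
    · obtain rfl : i = 0 := Subsingleton.elim (α := Fin 1) i 0
      exact hy
    · have hg : Measurable fun p : ℝ × EuclideanSpace ℝ (Fin n) =>
        ((fun _ => p.1 : Fin 1 → ℝ), p.2) := by fun_prop
      refine (hind0.comp hg measurable_id).congr (Eventually.of_forall fun ω => ?_) (by rfl)
      simp only [Function.comp_apply]
      congr 1
      ext i
      obtain rfl : i = 0 := Subsingleton.elim (α := Fin 1) i 0
      rfl
    · refine ⟨measurable_const, fun i j => measurable_const, fun a => Matrix.PosDef.one,
        measurable_const (a := multivariateGaussian (0 : EuclideanSpace ℝ (Fin n)) 1),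
        fun F hF => ?_⟩
      have hyθ : IndepFun y₀ θ μ := h.indepFun_init.comp measurable_id measurable_fst
      have hl := (indepFun_iff_map_prod_eq_prod_map_map hy.aemeasurable hθ.aemeasurable).1 hyθ
      rw [h.hasLaw_param.map_eq] at hl
      have hG : Measurable fun p : ℝ × EuclideanSpace ℝ (Fin n) =>
        F ((fun _ => p.1 : Fin (0 + 1) → ℝ), p.2) := by fun_prop
      have ho : ∀ ω, outputs f σ θ₀ θ y₀ w 0 ω = fun _ => y₀ ω := by
        intro ω
        ext i
        obtain rfl : i = 0 := Subsingleton.elim (α := Fin 1) i 0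
        rfl
      have h1 := lintegral_map hG (hy.prodMk hθ) (μ := μ)
      rw [hl, lintegral_prod _ hG.aemeasurable,
        lintegral_map hG.lintegral_prod_right' hy] at h1
      simp only [ho]
      exact h1.symm
  | succ t ih =>
    obtain ⟨hm, hind, hpost⟩ := ih
    have hφ : Measurable fun a : Fin (t + 1) → ℝ => phi f (a (Fin.last t)) := by fun_prop
    have hest := hpost.measurable_mean
    have hnoise : IndepFun (fun ω => (outputs f σ θ₀ θ y₀ w t ω, θ ω)) (w (t + 1)) μ :=
      hind.comp (ψ := fun v : ℕ → ℝ => v 0) measurable_id (by fun_prop)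
    have hinn : Measurable fun p : ((Fin (t + 1) → ℝ) × EuclideanSpace ℝ (Fin n)) × ℝ =>
        phi f (p.1.1 (Fin.last t)) ⬝ᵥ (p.1.2.ofLp - (observer f σ θ₀.ofLp t p.1.1).est) + p.2 := by
      have h1 : ∀ i, Measurable fun p : ((Fin (t + 1) → ℝ) × EuclideanSpace ℝ (Fin n)) × ℝ =>
        phi f (p.1.1 (Fin.last t)) i := fun i => by fun_prop
      have h2 : ∀ i, Measurable fun p : ((Fin (t + 1) → ℝ) × EuclideanSpace ℝ (Fin n)) × ℝ =>
        (observer f σ θ₀.ofLp t p.1.1).est i := fun i =>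
        (measurable_pi_apply i).comp (hest.comp (measurable_fst.comp measurable_fst))
      simp only [dotProduct, Pi.sub_apply]
      fun_prop
    have hsucc : ∀ ω, outputs f σ θ₀ θ y₀ w (t + 1) ω =
        Fin.snoc (α := fun _ => ℝ) (outputs f σ θ₀ θ y₀ w t ω)
          (phi f (outputs f σ θ₀ θ y₀ w t ω (Fin.last t)) ⬝ᵥ ((θ ω).ofLp -
            (observer f σ θ₀.ofLp t (outputs f σ θ₀ θ y₀ w t ω)).est) + w (t + 1) ω) := by
      intro ω
      rw [outputs_succ, closedLoop_succ_y]
    have hsnoc := measurable_snoc (t + 1)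
    have hG : Measurable fun p : ((Fin (t + 1) → ℝ) × EuclideanSpace ℝ (Fin n)) × ℝ =>
        (Fin.snoc (α := fun _ => ℝ) p.1.1 (phi f (p.1.1 (Fin.last t)) ⬝ᵥ
          (p.1.2.ofLp - (observer f σ θ₀.ofLp t p.1.1).est) + p.2) : Fin (t + 1 + 1) → ℝ) :=
      hsnoc.comp ((measurable_fst.comp measurable_fst).prodMk hinn)
    refine ⟨?_, ?_, ?_⟩
    · have h1 := hG.comp ((hm.prodMk hθ).prodMk (hw (t + 1)))
      convert h1 using 1
      ext1 ω
      exact hsucc ω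
    · have hfut : IndepFun (fun ω => (outputs f σ θ₀ θ y₀ w t ω, θ ω))
          (fun ω => (w (t + 1) ω, fun k => w (t + 1 + 1 + k) ω)) μ := by
        have hg : Measurable fun v : ℕ → ℝ => (v 0, fun k => v (k + 1)) := by fun_prop
        refine (hind.comp measurable_id hg).congr (by rfl) (Eventually.of_forall fun ω => ?_)
        simp only [Function.comp_apply, add_zero]
        congr 1
        ext k
        congr 1
        ring
      have h1 := indepFun_prodMk_left_of_indepFun (hm.prodMk hθ) (hw (t + 1)) (by fun_prop) hfut
        (indepFun_future hw h.iIndepFun_noise t)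
      refine (h1.comp (hG.prodMk (measurable_snd.comp measurable_fst)) measurable_id).congr
        (Eventually.of_forall fun ω => ?_) (by rfl)
      simp only [Function.comp_apply]
      rw [hsucc]
    · have h1 := (hpost.update hσ hφ hm hθ (h.hasLaw_noise t) hnoise).comp
        (e := fun p => (Fin.snoc (α := fun _ => ℝ) p.1 p.2 : Fin (t + 1 + 1) → ℝ))
        (d := fun b => (Fin.init b, b (Fin.last (t + 1)))) hsnoc
        (by unfold Fin.init; fun_prop) (by simp)
      -- the updated mean and covariance are those of the least-squares recursion
      convert h1 using 1
      · ext1 ω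
        exact hsucc ω
      · ext1 b
        simp only [observer]
        rw [nextEst_eq f hσ (hpost.posDef _), observer_y]
      · ext1 b
        simp only [observer]
        rw [nextP_eq, observer_y]

/-- The variance of the next output given the outputs `a = (y_0, …, y_t)`. -/
def predVar (f : Fin n → ℝ → ℝ) (σ : ℝ) (θ₀ : EuclideanSpace ℝ (Fin n)) (t : ℕ)
    (a : Fin (t + 1) → ℝ) : ℝ :=
  innovVar σ (observer f σ θ₀.ofLp t a).P (phi f (a (Fin.last t)))

lemma ClosedLoopData.measurable_predVar (h : ClosedLoopData μ σ w θ₀ θ y₀)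
    (hf : ∀ j, Measurable (f j)) (hσ : 0 < σ) (t : ℕ) : Measurable (predVar f σ θ₀ t) := by
  have hphi := measurable_phi hf
  exact (h.posterior hf hσ t).2.2.measurable_innovVar (φ := fun a => phi f (a (Fin.last t)))
    (by fun_prop) σ

lemma ClosedLoopData.sq_le_predVar (h : ClosedLoopData μ σ w θ₀ θ y₀)
    (hf : ∀ j, Measurable (f j)) (hσ : 0 < σ) (t : ℕ) (a : Fin (t + 1) → ℝ) :
    σ ^ 2 ≤ predVar f σ θ₀ t a :=
  innovVar_ge ((h.posterior hf hσ t).2.2.posDef a) _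

lemma ClosedLoopData.measurable_output (h : ClosedLoopData μ σ w θ₀ θ y₀)
    (hf : ∀ j, Measurable (f j)) (hσ : 0 < σ) (t : ℕ) :
    Measurable fun ω => (closedLoop f σ θ₀ θ y₀ w t ω).y :=
  (measurable_pi_apply (Fin.last t)).comp (h.posterior (f := f) hf hσ t).1

/-- Given the outputs up to time `t`, the next output is centred Gaussian with variance
`predVar`. -/
lemma ClosedLoopData.lintegral_output (h : ClosedLoopData μ σ w θ₀ θ y₀)
    (hf : ∀ j, Measurable (f j)) (hσ : 0 < σ) (t : ℕ)
    {F : (Fin (t + 1) → ℝ) × ℝ → ENNReal} (hF : Measurable F) :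
    ∫⁻ ω, F (outputs f σ θ₀ θ y₀ w t ω, (closedLoop f σ θ₀ θ y₀ w (t + 1) ω).y) ∂μ =
      ∫⁻ ω, ∫⁻ z, F (outputs f σ θ₀ θ y₀ w t ω, z)
        ∂gaussianReal 0 (predVar f σ θ₀ t (outputs f σ θ₀ θ y₀ w t ω)).toNNReal ∂μ := by
  obtain ⟨hm, hind, hpost⟩ := h.posterior (f := f) hf hσ t
  have hphi := measurable_phi hf
  have hnoise : IndepFun (fun ω => (outputs f σ θ₀ θ y₀ w t ω, θ ω)) (w (t + 1)) μ :=
    hind.comp (ψ := fun v : ℕ → ℝ => v 0) measurable_id (by fun_prop)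
  have h1 := hpost.lintegral_predictive hσ (φ := fun a => phi f (a (Fin.last t))) (by fun_prop)
    hm h.measurable_param (h.hasLaw_noise t) hnoise hF
  simp only [closedLoop_succ_y]
  exact h1

/-- The Gaussian law of the next output as a kernel. -/
def predKernel (f : Fin n → ℝ → ℝ) (σ : ℝ) (θ₀ : EuclideanSpace ℝ (Fin n)) (t : ℕ)
    (hm : Measurable (predVar f σ θ₀ t)) : Kernel (Fin (t + 1) → ℝ) ℝ :=
  ⟨fun a => gaussianReal 0 (predVar f σ θ₀ t a).toNNReal, measurable_gaussianReal_var hm⟩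

lemma predKernel_apply {t : ℕ} (hm : Measurable (predVar f σ θ₀ t)) (a : Fin (t + 1) → ℝ) :
    predKernel f σ θ₀ t hm a = gaussianReal 0 (predVar f σ θ₀ t a).toNNReal := rfl

instance {t : ℕ} (hm : Measurable (predVar f σ θ₀ t)) :
    IsMarkovKernel (predKernel f σ θ₀ t hm) :=
  ⟨fun a => by rw [predKernel_apply]; infer_instance⟩

lemma ClosedLoopData.map_outputs_eq_compProd (h : ClosedLoopData μ σ w θ₀ θ y₀)
    (hf : ∀ j, Measurable (f j)) (hσ : 0 < σ) (t : ℕ) :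
    μ.map (fun ω => (outputs f σ θ₀ θ y₀ w t ω, (closedLoop f σ θ₀ θ y₀ w (t + 1) ω).y)) =
      μ.map (outputs f σ θ₀ θ y₀ w t) ⊗ₘ
        predKernel f σ θ₀ t (h.measurable_predVar hf hσ t) := by
  have hm := (h.posterior (f := f) hf hσ t).1
  refine Measure.ext_of_lintegral _ fun F hF => ?_
  have hm1 : IsProbabilityMeasure (μ.map (outputs f σ θ₀ θ y₀ w t)) :=
    Measure.isProbabilityMeasure_map hm.aemeasurable
  rw [lintegral_map hF (hm.prodMk (h.measurable_output hf hσ (t + 1))),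
    h.lintegral_output hf hσ t hF, Measure.lintegral_compProd hF,
    lintegral_map hF.lintegral_kernel_prod_right' hm]
  rfl

/-- The conditional standard deviation is the square root of the variance computed by the filter. -/
lemma ClosedLoopData.condSD_eq (h : ClosedLoopData μ σ w θ₀ θ y₀)
    (hf : ∀ j, Measurable (f j)) (hσ : 0 < σ) (t : ℕ) :
    ∀ᵐ ω ∂μ, condSD μ (fun k ω' => (closedLoop f σ θ₀ θ y₀ w k ω').y) t ω =
      √(predVar f σ θ₀ t (outputs f σ θ₀ θ y₀ w t ω)) := by
  have hm := (h.posterior (f := f) hf hσ t).1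
  have h1 := condDistrib_ae_eq_of_measure_eq_compProd (outputs f σ θ₀ θ y₀ w t)
    (h.measurable_output hf hσ (t + 1)).aemeasurable (h.map_outputs_eq_compProd hf hσ t)
  filter_upwards [ae_of_ae_map hm.aemeasurable h1] with ω hω
  have h2 : condSD μ (fun k ω' => (closedLoop f σ θ₀ θ y₀ w k ω').y) t ω =
    √(Var[id; condDistrib (fun ω' => (closedLoop f σ θ₀ θ y₀ w (t + 1) ω').y)
      (outputs f σ θ₀ θ y₀ w t) μ (outputs f σ θ₀ θ y₀ w t ω)]) := rfl
  rw [h2, hω, predKernel_apply, variance_id_gaussianReal, Real.coe_toNNReal]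
  exact (sq_nonneg σ).trans (h.sq_le_predVar hf hσ t _)

end ClosedLoop

/-! ### A strong law for one-step predictions -/

/-- Averages of a bounded sequence tend to zero as soon as they do along the squares: the squares
are so dense that the terms between two consecutive ones are negligible. -/
lemma tendsto_average_of_tendsto_average_sq {d : ℕ → ℝ} {C : ℝ} (hd : ∀ i, |d i| ≤ C)
    (h : Tendsto (fun k : ℕ => (∑ i ∈ Finset.range (k ^ 2), d i) / (k ^ 2 : ℝ)) atTop (nhds 0)) :
    Tendsto (fun N : ℕ => (∑ i ∈ Finset.range N, d i) / (N : ℝ)) atTop (nhds 0) := by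
  have hC : 0 ≤ C := (abs_nonneg _).trans (hd 0)
  have hsqrt : Tendsto Nat.sqrt atTop atTop := by
    refine tendsto_atTop.2 fun b => ?_
    filter_upwards [eventually_ge_atTop (b * b)] with N hN
    exact Nat.le_sqrt.2 hN
  have h1 := (h.abs.comp hsqrt)
  have h2 : Tendsto (fun N : ℕ => 2 * C / (Nat.sqrt N : ℝ)) atTop (nhds 0) :=
    (tendsto_const_div_atTop_nhds_zero_nat (2 * C)).comp hsqrt
  have h3 := h1.add h2
  rw [abs_zero, zero_add] at h3
  refine squeeze_zero_norm' ?_ h3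
  filter_upwards [eventually_ge_atTop 1] with N hN
  set k := Nat.sqrt N with hk
  have hk1 : 1 ≤ k := Nat.le_sqrt.2 (by simpa using hN)
  have hkN : k ^ 2 ≤ N := Nat.sqrt_le' N
  have hkN' : N ≤ k ^ 2 + 2 * k := by
    have := Nat.sqrt_le_add N
    rw [← hk] at this
    nlinarith
  have hsum : ∑ i ∈ Finset.range N, d i =
      ∑ i ∈ Finset.range (k ^ 2), d i + ∑ i ∈ Finset.Ico (k ^ 2) N, d i :=
    (Finset.sum_range_add_sum_Ico d hkN).symm
  have hrest : |∑ i ∈ Finset.Ico (k ^ 2) N, d i| ≤ 2 * C * k := by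
    calc |∑ i ∈ Finset.Ico (k ^ 2) N, d i| ≤ ∑ i ∈ Finset.Ico (k ^ 2) N, C :=
          (Finset.abs_sum_le_sum_abs _ _).trans (Finset.sum_le_sum fun i _ => hd i)
      _ = ((N - k ^ 2 : ℕ) : ℝ) * C := by simp
      _ ≤ (2 * k : ℕ) * C := by
          gcongr
          omega
      _ = 2 * C * k := by push_cast; ring
  have hkpos : (0 : ℝ) < k := by exact_mod_cast hk1
  have hle : (k : ℝ) ^ 2 ≤ N := by exact_mod_cast hkN
  have hN0 : (0 : ℝ) < N := by exact_mod_cast hN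
  rw [Real.norm_eq_abs, abs_div, abs_of_pos hN0]
  simp only [Function.comp_apply]
  rw [← hk, abs_div, abs_of_pos (by positivity : (0 : ℝ) < (k : ℝ) ^ 2)]
  calc |∑ i ∈ Finset.range N, d i| / (N : ℝ)
      ≤ (|∑ i ∈ Finset.range (k ^ 2), d i| + 2 * C * k) / (k : ℝ) ^ 2 := by
        gcongr
        rw [hsum]
        exact (abs_add_le _ _).trans (by gcongr)
    _ = _ := by
        field_simp

/-- The strong law of large numbers for uniformly bounded, pairwise orthogonal random variables. -/
lemma ae_tendsto_average_of_orthogonal {Ω : Type*} [MeasurableSpace Ω] {μ : Measure Ω}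
    [IsProbabilityMeasure μ] {D : ℕ → Ω → ℝ} {C : ℝ} (hD : ∀ i, Measurable (D i))
    (hC : ∀ i ω, |D i ω| ≤ C) (horth : ∀ i j, i < j → ∫ ω, D i ω * D j ω ∂μ = 0) :
    ∀ᵐ ω ∂μ, Tendsto (fun N : ℕ => (∑ i ∈ Finset.range N, D i ω) / (N : ℝ)) atTop (nhds 0) := by
  have hint : ∀ i j, Integrable (fun ω => D i ω * D j ω) μ := by
    intro i j
    refine Integrable.of_bound (by fun_prop) (C * C) (Eventually.of_forall fun ω => ?_)
    rw [Real.norm_eq_abs, abs_mul]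
    have := (abs_nonneg _).trans (hC i ω)
    gcongr
    · exact hC i ω
    · exact hC j ω
  have hvar : ∀ N : ℕ, ∫ ω, (∑ i ∈ Finset.range N, D i ω) ^ 2 ∂μ ≤ N * C ^ 2 := by
    intro N
    have h1 : ∀ ω, (∑ i ∈ Finset.range N, D i ω) ^ 2 =
        ∑ i ∈ Finset.range N, ∑ j ∈ Finset.range N, D i ω * D j ω := by
      intro ω
      rw [sq, Finset.sum_mul_sum]
    simp only [h1]
    rw [integral_finsetSum _ fun i _ => integrable_finsetSum _ fun j _ => hint i j]
    simp only [integral_finsetSum _ fun j _ => hint _ j]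
    calc ∑ i ∈ Finset.range N, ∑ j ∈ Finset.range N, ∫ ω, D i ω * D j ω ∂μ
        = ∑ i ∈ Finset.range N, ∫ ω, D i ω * D i ω ∂μ := by
          refine Finset.sum_congr rfl fun i hi => ?_
          refine Finset.sum_eq_single_of_mem i hi fun j _ hj => ?_
          rcases lt_or_gt_of_ne hj with h | h
          · simpa [mul_comm] using horth j i h
          · exact horth i j h
      _ ≤ ∑ i ∈ Finset.range N, C ^ 2 := by
          refine Finset.sum_le_sum fun i _ => ?_
          calc ∫ ω, D i ω * D i ω ∂μ ≤ ∫ _, C ^ 2 ∂μ := by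
                refine integral_mono (hint i i) (integrable_const _) fun ω => ?_
                have h2 := hC i ω
                rw [← sq, ← sq_abs]
                exact pow_le_pow_left₀ (abs_nonneg _) h2 2
            _ = C ^ 2 := by simp
      _ = N * C ^ 2 := by simp
  -- along the squares the second moments of the averages are summable
  let x : ℕ → Ω → ℝ := fun k ω => (∑ i ∈ Finset.range (k ^ 2), D i ω) / (k ^ 2 : ℝ)
  have hx : ∀ k, Measurable (x k) := fun k => by fun_prop
  have hxint : ∀ k, ∫⁻ ω, ENNReal.ofReal (x k ω ^ 2) ∂μ ≤ ENNReal.ofReal (C ^ 2 / (k : ℝ) ^ 2) := by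
    intro k
    have hb : Integrable (fun ω => x k ω ^ 2) μ := by
      have h1 : ∀ ω, x k ω ^ 2 = (∑ i ∈ Finset.range (k ^ 2), ∑ j ∈ Finset.range (k ^ 2),
          D i ω * D j ω) / ((k : ℝ) ^ 2) ^ 2 := by
        intro ω
        rw [div_pow, sq (∑ i ∈ Finset.range (k ^ 2), D i ω), Finset.sum_mul_sum]
      simp only [h1]
      exact (integrable_finsetSum _ fun i _ =>
        integrable_finsetSum _ fun j _ => hint i j).div_const _
    rw [← ofReal_integral_eq_lintegral_ofReal hb (Eventually.of_forall fun ω => sq_nonneg _)]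
    refine ENNReal.ofReal_le_ofReal ?_
    simp only [x, div_pow]
    rw [integral_div]
    have h2 := hvar (k ^ 2)
    push_cast at h2
    rcases Nat.eq_zero_or_pos k with rfl | hk
    · simp
    · have : (0 : ℝ) < k := by exact_mod_cast hk
      rw [div_le_div_iff₀ (by positivity) (by positivity)]
      calc _ ≤ (k : ℝ) ^ 2 * C ^ 2 * (k : ℝ) ^ 2 := by gcongr
        _ = _ := by ring
  have hsum : ∫⁻ ω, ∑' k, ENNReal.ofReal (x k ω ^ 2) ∂μ ≠ ⊤ := by
    rw [lintegral_tsum fun k => by fun_prop]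
    refine ne_top_of_le_ne_top ?_ (ENNReal.tsum_le_tsum hxint)
    have hs : Summable fun k : ℕ => C ^ 2 / (k : ℝ) ^ 2 := by
      simpa [div_eq_mul_inv] using
        (Real.summable_nat_pow_inv.2 (by norm_num : 1 < 2)).mul_left (C ^ 2)
    exact hs.tsum_ofReal_ne_top
  have hmeas : Measurable fun ω => ∑' k, ENNReal.ofReal (x k ω ^ 2) :=
    Measurable.tsum fun k => by fun_prop
  filter_upwards [ae_lt_top hmeas hsum] with ω hω
  refine tendsto_average_of_tendsto_average_sq (fun i => hC i ω) ?_
  have h1 := ENNReal.tendsto_atTop_zero_of_tsum_ne_top hω.ne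
  have h2 := (ENNReal.tendsto_toReal ENNReal.zero_ne_top).comp h1
  have h3 : Tendsto (fun k => x k ω ^ 2) atTop (nhds 0) := by
    refine (h2.congr fun k => ?_)
    simp [ENNReal.toReal_ofReal (sq_nonneg _)]
  have h4 := h3.sqrt
  simp only [Real.sqrt_sq_eq_abs, Real.sqrt_zero] at h4
  exact (tendsto_zero_iff_abs_tendsto_zero _).2 h4

section ClosedLoop

variable {Ω : Type*} [MeasurableSpace Ω] {μ : Measure Ω} [IsProbabilityMeasure μ]
  {f : Fin n → ℝ → ℝ} {σ : ℝ} {w : ℕ → Ω → ℝ} {θ₀ : EuclideanSpace ℝ (Fin n)}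
  {θ : Ω → EuclideanSpace ℝ (Fin n)} {y₀ : Ω → ℝ}

/-- A bounded function of the outputs has the same time average as its one-step predictions. -/
lemma ClosedLoopData.tendsto_average (h : ClosedLoopData μ σ w θ₀ θ y₀)
    (hf : ∀ j, Measurable (f j)) (hσ : 0 < σ) {g : ℝ → ℝ} (hg : Measurable g) {C : ℝ}
    (hC : ∀ y, |g y| ≤ C) :
    ∀ᵐ ω ∂μ, Tendsto (fun N : ℕ => (∑ i ∈ Finset.range N,
      (g (closedLoop f σ θ₀ θ y₀ w (i + 1) ω).y -
        ∫ z, g z ∂gaussianReal 0 (predVar f σ θ₀ i (outputs f σ θ₀ θ y₀ w i ω)).toNNReal)) /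
          (N : ℝ)) atTop (nhds 0) := by
  have hm : ∀ t, Measurable (outputs f σ θ₀ θ y₀ w t) := fun t => (h.posterior hf hσ t).1
  have hy := fun t => h.measurable_output (f := f) hf hσ t
  let G : (t : ℕ) → (Fin (t + 1) → ℝ) → ℝ := fun t a =>
    ∫ z, g z ∂gaussianReal 0 (predVar f σ θ₀ t a).toNNReal
  have hGm : ∀ t, Measurable (G t) := by
    intro t
    have h1 : StronglyMeasurable fun p : (Fin (t + 1) → ℝ) × ℝ => g p.2 :=
      (hg.comp measurable_snd).stronglyMeasurable
    exact (h1.integral_kernel_prod_right'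
      (κ := predKernel f σ θ₀ t (h.measurable_predVar hf hσ t))).measurable
  have hGb : ∀ t a, |G t a| ≤ C := by
    intro t a
    have := norm_integral_le_of_norm_le_const (f := g)
      (μ := gaussianReal 0 (predVar f σ θ₀ t a).toNNReal) (Eventually.of_forall hC)
    simpa using this
  refine ae_tendsto_average_of_orthogonal (C := C + C)
    (D := fun i ω => g (closedLoop f σ θ₀ θ y₀ w (i + 1) ω).y - G i (outputs f σ θ₀ θ y₀ w i ω))
    (fun i => (hg.comp (hy (i + 1))).sub ((hGm i).comp (hm i)))
    (fun i ω => (abs_sub _ _).trans (add_le_add (hC _) (hGb _ _))) fun i j hij => ?_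
  -- the earlier difference is a function of the outputs up to time `j`, and the later one has
  -- conditional mean zero given these
  let H : (Fin (j + 1) → ℝ) → ℝ := fun a =>
    g (a ⟨i + 1, by omega⟩) - G i (fun l => a ⟨l, by omega⟩)
  have hHm : Measurable H := by
    have := hGm i
    exact (hg.comp (measurable_pi_apply _)).sub ((hGm i).comp (by fun_prop))
  have hHb : ∀ a, |H a| ≤ C + C := fun a =>
    (abs_sub _ _).trans (add_le_add (hC _) (hGb _ _))
  let F : (Fin (j + 1) → ℝ) × ℝ → ℝ := fun p => H p.1 * (g p.2 - G j p.1)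
  have hFm : Measurable F :=
    (hHm.comp measurable_fst).mul ((hg.comp measurable_snd).sub ((hGm j).comp measurable_fst))
  have hFi : Integrable F (μ.map (outputs f σ θ₀ θ y₀ w j) ⊗ₘ
      predKernel f σ θ₀ j (h.measurable_predVar hf hσ j)) := by
    have hm1 : IsProbabilityMeasure (μ.map (outputs f σ θ₀ θ y₀ w j)) :=
      Measure.isProbabilityMeasure_map (hm j).aemeasurable
    refine Integrable.of_bound hFm.aestronglyMeasurable ((C + C) * (C + C))
      (Eventually.of_forall fun p => ?_)
    have hC0 : 0 ≤ C := (abs_nonneg _).trans (hC 0)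
    rw [Real.norm_eq_abs, abs_mul]
    exact mul_le_mul (hHb _) ((abs_sub _ _).trans (add_le_add (hC _) (hGb _ _)))
      (abs_nonneg _) (by positivity)
  have h1 : ∫ ω, F (outputs f σ θ₀ θ y₀ w j ω, (closedLoop f σ θ₀ θ y₀ w (j + 1) ω).y) ∂μ = 0 := by
    rw [← integral_map ((hm j).prodMk (hy (j + 1))).aemeasurable hFm.aestronglyMeasurable,
      h.map_outputs_eq_compProd hf hσ j]
    have hm1 : IsProbabilityMeasure (μ.map (outputs f σ θ₀ θ y₀ w j)) :=
      Measure.isProbabilityMeasure_map (hm j).aemeasurable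
    rw [Measure.integral_compProd hFi]
    refine integral_eq_zero_of_ae (Eventually.of_forall fun a => ?_)
    simp only [F, predKernel_apply]
    rw [integral_const_mul, integral_sub (Integrable.of_bound (by fun_prop) C
      (Eventually.of_forall hC)) (integrable_const _)]
    simp [G]
  exact h1

end ClosedLoop

/-! ### Excitation by Gaussian outputs -/

/-- For centred Gaussian laws, enlarging the variance from `σ²` to `v` costs at most the factor
`σ / √v` in the density. -/
lemma smul_gaussianReal_le {σ v : ℝ} (hσ : 0 < σ) (hv : σ ^ 2 ≤ v) :
    ENNReal.ofReal (σ / √v) • gaussianReal 0 (σ ^ 2).toNNReal ≤ gaussianReal 0 v.toNNReal := by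
  have hσ2 : 0 < σ ^ 2 := by positivity
  have hv0 : 0 < v := hσ2.trans_le hv
  rw [gaussianReal_of_var_ne_zero _ (by simpa using hσ.ne'),
    gaussianReal_of_var_ne_zero _ (by simpa using hv0),
    ← withDensity_smul _ (measurable_gaussianPDF _ _)]
  refine withDensity_mono (Eventually.of_forall fun y => ?_)
  simp only [Pi.smul_apply, smul_eq_mul, gaussianPDF]
  rw [← ENNReal.ofReal_mul (by positivity)]
  refine ENNReal.ofReal_le_ofReal ?_
  simp only [gaussianPDFReal, Real.coe_toNNReal _ hσ2.le, Real.coe_toNNReal _ hv0.le, sub_zero]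
  have h1 : σ / √v * (√(2 * Real.pi * σ ^ 2))⁻¹ = (√(2 * Real.pi * v))⁻¹ := by
    rw [Real.sqrt_mul (by positivity), Real.sqrt_mul (by positivity) v, Real.sqrt_sq hσ.le]
    have : 0 < √v := Real.sqrt_pos.2 hv0
    field_simp
  rw [← mul_assoc, h1]
  refine mul_le_mul_of_nonneg_left (Real.exp_le_exp.2 ?_) (by positivity)
  rw [neg_div, neg_div]
  gcongr

/-- The entries of the matrix `φ φᵀ / (1 + |φ|²)`. The normalisation makes them bounded without any
restriction of the outputs to a compact set. -/
def normGram (f : Fin n → ℝ → ℝ) (j k : Fin n) (y : ℝ) : ℝ :=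
  f j y * f k y / (1 + ∑ l, f l y ^ 2)

variable {f : Fin n → ℝ → ℝ}

lemma one_le_one_add_sum_sq (y : ℝ) : 1 ≤ 1 + ∑ l, f l y ^ 2 := by
  have : 0 ≤ ∑ l, f l y ^ 2 := Finset.sum_nonneg fun l _ => sq_nonneg _
  linarith

lemma measurable_normGram (hf : ∀ j, Measurable (f j)) (j k : Fin n) :
    Measurable (normGram f j k) := by
  unfold normGram
  fun_prop

lemma abs_normGram_le (j k : Fin n) (y : ℝ) : |normGram f j k y| ≤ 1 := by
  have h1 := one_le_one_add_sum_sq (f := f) y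
  have hj : f j y ^ 2 ≤ ∑ l, f l y ^ 2 :=
    Finset.single_le_sum (f := fun l => f l y ^ 2) (fun l _ => sq_nonneg _) (Finset.mem_univ j)
  have hk : f k y ^ 2 ≤ ∑ l, f l y ^ 2 :=
    Finset.single_le_sum (f := fun l => f l y ^ 2) (fun l _ => sq_nonneg _) (Finset.mem_univ k)
  rw [normGram, abs_div, abs_of_pos (by linarith : 0 < 1 + ∑ l, f l y ^ 2),
    div_le_one (by linarith), abs_le]
  constructor
  · nlinarith [sq_nonneg (f j y + f k y)]
  · nlinarith [sq_nonneg (f j y - f k y)]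

lemma sum_normGram_eq (x : Fin n → ℝ) (y : ℝ) :
    ∑ j, ∑ k, x j * x k * normGram f j k y = (phi f y ⬝ᵥ x) ^ 2 / (1 + ∑ l, f l y ^ 2) := by
  rw [sq, dotProduct, Finset.sum_mul_sum, Finset.sum_div]
  refine Finset.sum_congr rfl fun j _ => ?_
  rw [Finset.sum_div]
  refine Finset.sum_congr rfl fun k _ => ?_
  simp only [normGram, phi]
  ring

lemma sum_normGram_nonneg (x : Fin n → ℝ) (y : ℝ) :
    0 ≤ ∑ j, ∑ k, x j * x k * normGram f j k y := by
  have := one_le_one_add_sum_sq (f := f) y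
  rw [sum_normGram_eq]
  positivity

lemma sum_normGram_le (x : Fin n → ℝ) (y : ℝ) :
    ∑ j, ∑ k, x j * x k * normGram f j k y ≤ (phi f y ⬝ᵥ x) ^ 2 := by
  rw [sum_normGram_eq]
  exact div_le_self (sq_nonneg _) (one_le_one_add_sum_sq y)

lemma integrable_normGram (hf : ∀ j, Measurable (f j)) (j k : Fin n) (μ : Measure ℝ)
    [IsProbabilityMeasure μ] : Integrable (normGram f j k) μ :=
  Integrable.of_bound (measurable_normGram hf j k).aestronglyMeasurable 1
    (Eventually.of_forall fun y => abs_normGram_le j k y)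

lemma integrable_sum_normGram (hf : ∀ j, Measurable (f j)) (x : Fin n → ℝ) (μ : Measure ℝ)
    [IsProbabilityMeasure μ] : Integrable (fun y => ∑ j, ∑ k, x j * x k * normGram f j k y) μ :=
  integrable_finsetSum _ fun j _ => integrable_finsetSum _ fun k _ =>
    (integrable_normGram hf j k μ).const_mul _

lemma integral_sum_normGram (hf : ∀ j, Measurable (f j)) (x : Fin n → ℝ) (μ : Measure ℝ)
    [IsProbabilityMeasure μ] : ∫ y, ∑ j, ∑ k, x j * x k * normGram f j k y ∂μ =
      ∑ j, ∑ k, x j * x k * ∫ y, normGram f j k y ∂μ := by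
  rw [integral_finsetSum _ fun j _ => integrable_finsetSum _ fun k _ =>
    (integrable_normGram hf j k μ).const_mul _]
  refine Finset.sum_congr rfl fun j _ => ?_
  rw [integral_finsetSum _ fun k _ => (integrable_normGram hf j k μ).const_mul _]
  simp only [integral_const_mul]

/-- Linear independence of the continuous functions `f_j` on the open set `E` makes the normalised
Gram matrix positive definite under any nondegenerate Gaussian law. -/
lemma integral_sum_normGram_pos (hf : ∀ j, Measurable (f j)) {E : Set ℝ} (hE : IsOpen E)
    (hfE : ∀ j, ContinuousOn (f j) E)
    (hlin : LinearIndependent ℝ (fun (j : Fin n) (x : E) => f j x)) {v : NNReal} (hv : v ≠ 0)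
    {x : Fin n → ℝ} (hx : x ≠ 0) :
    0 < ∫ y, ∑ j, ∑ k, x j * x k * normGram f j k y ∂gaussianReal 0 v := by
  rw [integral_pos_iff_support_of_nonneg (fun y => sum_normGram_nonneg x y)
    (integrable_sum_normGram hf x _)]
  have hne : ∃ y ∈ E, phi f y ⬝ᵥ x ≠ 0 := by
    by_contra! hcon
    refine hx (funext fun j => ?_)
    refine Fintype.linearIndependent_iff.1 hlin x ?_ j
    ext y
    have := hcon y y.2
    simpa [dotProduct, phi, mul_comm] using this
  obtain ⟨y₁, hy₁, hy₁'⟩ := hne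
  have hcont : ContinuousOn (fun y => phi f y ⬝ᵥ x) E := by
    simp only [dotProduct, phi]
    fun_prop
  have hopen : IsOpen (E ∩ (fun y => phi f y ⬝ᵥ x) ⁻¹' {0}ᶜ) :=
    hcont.isOpen_inter_preimage hE isOpen_compl_singleton
  have hpos : 0 < volume (E ∩ (fun y => phi f y ⬝ᵥ x) ⁻¹' {0}ᶜ) :=
    hopen.measure_pos volume ⟨y₁, hy₁, hy₁'⟩
  have hsub : E ∩ (fun y => phi f y ⬝ᵥ x) ⁻¹' {0}ᶜ ⊆
      Function.support fun y => ∑ j, ∑ k, x j * x k * normGram f j k y := by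
    rintro y ⟨-, hy⟩
    rw [Function.mem_support, sum_normGram_eq]
    have := one_le_one_add_sum_sq (f := f) y
    exact div_ne_zero (pow_ne_zero 2 hy) (by positivity)
  refine (pos_iff_ne_zero.2 fun h0 => hpos.ne' ?_).trans_le (measure_mono hsub)
  exact gaussianReal_absolutelyContinuous' 0 hv h0

/-- Positivity on the compact unit sphere gives a uniform lower bound there. -/
lemma exists_coercivity_const (hn : 0 < n) (hf : ∀ j, Measurable (f j)) {E : Set ℝ}
    (hE : IsOpen E) (hfE : ∀ j, ContinuousOn (f j) E)
    (hlin : LinearIndependent ℝ (fun (j : Fin n) (x : E) => f j x)) {v : NNReal} (hv : v ≠ 0) :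
    ∃ c : ℝ, 0 < c ∧ ∀ x : Fin n → ℝ, x ⬝ᵥ x = 1 →
      c ≤ ∫ y, ∑ j, ∑ k, x j * x k * normGram f j k y ∂gaussianReal 0 v := by
  have : Nonempty (Fin n) := ⟨⟨0, hn⟩⟩
  have hcont : Continuous fun x : EuclideanSpace ℝ (Fin n) =>
      ∫ y, ∑ j, ∑ k, x j * x k * normGram f j k y ∂gaussianReal 0 v := by
    have h1 : ∀ x : EuclideanSpace ℝ (Fin n), _ :=
      fun x => integral_sum_normGram hf x.ofLp (gaussianReal 0 v)
    simp only [h1]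
    fun_prop
  obtain ⟨x₀, hx₀, hmin⟩ := (isCompact_sphere (0 : EuclideanSpace ℝ (Fin n)) 1).exists_isMinOn
    (NormedSpace.sphere_nonempty.2 zero_le_one) hcont.continuousOn
  refine ⟨_, integral_sum_normGram_pos hf hE hfE hlin hv (x := x₀.ofLp) ?_, fun x hx => ?_⟩
  · intro h0
    have : x₀ = 0 := by
      ext i
      simp [h0]
    simp [this] at hx₀
  -- the minimum over the sphere of `EuclideanSpace` bounds the form at vectors of `Fin n → ℝ`
  · refine isMinOn_iff.1 hmin (WithLp.toLp 2 x) ?_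
    rw [mem_sphere_zero_iff_norm, EuclideanSpace.norm_eq, Real.sqrt_eq_one]
    simpa [dotProduct, sq] using hx

/-- The expected normalised Gram form under a centred Gaussian output of variance `v ≥ σ²` is at
least `σ / √v` times its value at variance `σ²`. -/
lemma mul_integral_le_integral_gaussianReal {σ v : ℝ} (hσ : 0 < σ) (hv : σ ^ 2 ≤ v)
    (hf : ∀ j, Measurable (f j)) (x : Fin n → ℝ) :
    σ / √v * ∫ y, ∑ j, ∑ k, x j * x k * normGram f j k y ∂gaussianReal 0 (σ ^ 2).toNNReal ≤
      ∫ y, ∑ j, ∑ k, x j * x k * normGram f j k y ∂gaussianReal 0 v.toNNReal := by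
  have h := integral_mono_measure (smul_gaussianReal_le hσ hv)
    (Eventually.of_forall fun y => sum_normGram_nonneg (f := f) x y)
    (integrable_sum_normGram hf x _)
  rwa [integral_smul_measure, ENNReal.toReal_ofReal (by positivity), smul_eq_mul] at h

/-! ### The smallest eigenvalue of the information matrix -/

lemma le_lambdaMin (hn : 0 < n) {A : Matrix (Fin n) (Fin n) ℝ} (hA : A.IsHermitian) {b : ℝ}
    (hb : ∀ x : Fin n → ℝ, x ⬝ᵥ x = 1 → b ≤ x ⬝ᵥ (A *ᵥ x)) : b ≤ lambdaMin A := by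
  have : Nonempty (Fin n) := ⟨⟨0, hn⟩⟩
  rw [lambdaMin, hA.spectrum_real_eq_range_eigenvalues]
  refine le_csInf (Set.range_nonempty _) ?_
  rintro _ ⟨i, rfl⟩
  rw [hA.eigenvalues_eq]
  refine (hb (hA.eigenvectorBasis i).ofLp ?_).trans_eq (by simp)
  rw [← inner_eq_dotProduct, real_inner_self_eq_norm_sq, hA.eigenvectorBasis.norm_eq_one]
  norm_num

section ClosedLoop

variable {Ω : Type*} {σ : ℝ} {w : ℕ → Ω → ℝ} {θ₀ : EuclideanSpace ℝ (Fin n)}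
  {θ : Ω → EuclideanSpace ℝ (Fin n)} {y₀ : Ω → ℝ}

lemma posDef_closedLoop_P (hσ : 0 < σ) (t : ℕ) (ω : Ω) :
    (closedLoop f σ θ₀ θ y₀ w t ω).P.PosDef := by
  induction t with
  | zero => exact Matrix.PosDef.one
  | succ t ih => exact posDef_condCov hσ ih _

/-- The inverse of `P_t` is the information matrix `I + σ⁻² ∑ φ_i φ_iᵀ`, as a quadratic form. -/
lemma dotProduct_inv_closedLoop_P (hσ : 0 < σ) (t : ℕ) (ω : Ω) (x : Fin n → ℝ) :
    x ⬝ᵥ ((closedLoop f σ θ₀ θ y₀ w t ω).P⁻¹ *ᵥ x) = x ⬝ᵥ x + (σ ^ 2)⁻¹ *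
      ∑ i ∈ Finset.range t, (phi f (closedLoop f σ θ₀ θ y₀ w i ω).y ⬝ᵥ x) ^ 2 := by
  induction t with
  | zero =>
    have : (closedLoop f σ θ₀ θ y₀ w 0 ω).P = 1 := rfl
    simp [this]
  | succ t ih =>
    have : (closedLoop f σ θ₀ θ y₀ w (t + 1) ω).P =
      condCov σ (closedLoop f σ θ₀ θ y₀ w t ω).P (phi f (closedLoop f σ θ₀ θ y₀ w t ω).y) := rfl
    rw [this, inv_condCov hσ (posDef_closedLoop_P hσ t ω), Matrix.add_mulVec, dotProduct_add, ih,
      Finset.sum_range_succ, Matrix.smul_mulVec, dotProduct_smul, Matrix.vecMulVec_mulVec,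
      op_smul_eq_smul, dotProduct_smul, dotProduct_comm x (phi f _)]
    simp only [smul_eq_mul]
    ring

/-- The pathwise lower bound: up to the fluctuations of the normalised Gram entries around their
predictions, the smallest eigenvalue of the information matrix is at least a multiple of the sum of
the inverse predictive standard deviations. -/
lemma le_lambdaMin_closedLoop (hn : 0 < n) (hσ : 0 < σ) (hf : ∀ j, Measurable (f j)) {c : ℝ}
    (hc : ∀ x : Fin n → ℝ, x ⬝ᵥ x = 1 →
      c ≤ ∫ y, ∑ j, ∑ k, x j * x k * normGram f j k y ∂gaussianReal 0 (σ ^ 2).toNNReal)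
    {v : ℕ → ℝ} (hv : ∀ i, σ ^ 2 ≤ v i) (t : ℕ) (ω : Ω) :
    c / σ * ∑ i ∈ Finset.range t, 1 / √(v i) -
      (σ ^ 2)⁻¹ * ∑ j, ∑ k, |∑ i ∈ Finset.range t,
        (normGram f j k (closedLoop f σ θ₀ θ y₀ w (i + 1) ω).y -
          ∫ z, normGram f j k z ∂gaussianReal 0 (v i).toNNReal)| ≤
      lambdaMin (closedLoop f σ θ₀ θ y₀ w (t + 1) ω).P⁻¹ := by
  refine le_lambdaMin hn (posDef_closedLoop_P hσ _ ω).inv.isHermitian fun x hx => ?_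
  -- the summand of the initial output, whose law is arbitrary, is dropped
  rw [dotProduct_inv_closedLoop_P hσ, hx, Finset.sum_range_succ']
  set y : ℕ → ℝ := fun i => (closedLoop f σ θ₀ θ y₀ w (i + 1) ω).y with hy
  set R : Fin n → Fin n → ℝ := fun j k => ∑ i ∈ Finset.range t, (normGram f j k (y i) -
    ∫ z, normGram f j k z ∂gaussianReal 0 (v i).toNNReal) with hR
  have habs : ∀ j, |x j| ≤ 1 := by
    intro j
    have : x j * x j ≤ x ⬝ᵥ x :=
      Finset.single_le_sum (f := fun j => x j * x j) (fun l _ => mul_self_nonneg _)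
        (Finset.mem_univ j)
    rw [hx, ← sq] at this
    exact (sq_le_one_iff_abs_le_one _).1 this
  have h1 : c * (σ * ∑ i ∈ Finset.range t, 1 / √(v i)) ≤
      ∑ i ∈ Finset.range t, ∑ j, ∑ k, x j * x k *
        ∫ z, normGram f j k z ∂gaussianReal 0 (v i).toNNReal := by
    rw [Finset.mul_sum, Finset.mul_sum]
    refine Finset.sum_le_sum fun i _ => ?_
    rw [← integral_sum_normGram hf]
    refine le_trans ?_ (mul_integral_le_integral_gaussianReal hσ (hv i) hf x)
    rw [mul_one_div, mul_comm c]
    gcongr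
    exact hc x hx
  have h2 : ∑ i ∈ Finset.range t, ∑ j, ∑ k, x j * x k * normGram f j k (y i) =
      ∑ i ∈ Finset.range t, ∑ j, ∑ k, x j * x k *
        (∫ z, normGram f j k z ∂gaussianReal 0 (v i).toNNReal) + ∑ j, ∑ k, x j * x k * R j k := by
    have h3 : ∑ j, ∑ k, x j * x k * R j k = ∑ i ∈ Finset.range t, ∑ j, ∑ k, x j * x k *
        (normGram f j k (y i) - ∫ z, normGram f j k z ∂gaussianReal 0 (v i).toNNReal) := by
      simp only [hR, Finset.mul_sum]
      rw [Finset.sum_comm, Finset.sum_comm (s := Finset.range t), Finset.sum_comm]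
      refine Finset.sum_congr rfl fun j _ => ?_
      rw [Finset.sum_comm]
    rw [h3, ← Finset.sum_add_distrib]
    refine Finset.sum_congr rfl fun i _ => ?_
    rw [← Finset.sum_add_distrib]
    refine Finset.sum_congr rfl fun j _ => ?_
    rw [← Finset.sum_add_distrib]
    refine Finset.sum_congr rfl fun k _ => ?_
    ring
  have h4 : -∑ j, ∑ k, |R j k| ≤ ∑ j, ∑ k, x j * x k * R j k := by
    rw [← Finset.sum_neg_distrib]
    refine Finset.sum_le_sum fun j _ => ?_
    rw [← Finset.sum_neg_distrib]
    refine Finset.sum_le_sum fun k _ => ?_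
    refine le_trans (neg_le_neg ?_) (neg_abs_le _)
    rw [abs_mul, abs_mul]
    exact mul_le_of_le_one_left (abs_nonneg _) (mul_le_one₀ (habs j) (abs_nonneg _) (habs k))
  have h5 : ∑ i ∈ Finset.range t, ∑ j, ∑ k, x j * x k * normGram f j k (y i) ≤
      ∑ i ∈ Finset.range t, (phi f (y i) ⬝ᵥ x) ^ 2 :=
    Finset.sum_le_sum fun i _ => sum_normGram_le x (y i)
  have h6 : c / σ * ∑ i ∈ Finset.range t, 1 / √(v i) =
      (σ ^ 2)⁻¹ * (c * (σ * ∑ i ∈ Finset.range t, 1 / √(v i))) := by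
    field_simp
  rw [h6, ← mul_sub]
  have h7 : c * (σ * ∑ i ∈ Finset.range t, 1 / √(v i)) - ∑ j, ∑ k, |R j k| ≤
      ∑ i ∈ Finset.range t, (phi f (y i) ⬝ᵥ x) ^ 2 +
        (phi f (closedLoop f σ θ₀ θ y₀ w 0 ω).y ⬝ᵥ x) ^ 2 := by
    have := sq_nonneg (phi f (closedLoop f σ θ₀ θ y₀ w 0 ω).y ⬝ᵥ x)
    linarith
  have h8 := mul_le_mul_of_nonneg_left h7 (by positivity : 0 ≤ (σ ^ 2)⁻¹)
  linarith

end ClosedLoop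

/-- The passage to the lower limits in the extended reals, with an error that tends to zero. -/
lemma mul_liminf_le_liminf {M : ℝ} (hM : 0 ≤ M) {a b e : ℕ → ℝ} (he : Tendsto e atTop (nhds 0))
    (h : ∀ t, M * a t - e t ≤ b t) :
    (M : EReal) * liminf (fun t => (a t : EReal)) atTop ≤
      liminf (fun t => (b t : EReal)) atTop := by
  have h1 : liminf (fun t => ((-e t : ℝ) : EReal)) atTop = 0 := by
    have h2 : Tendsto (fun t => ((-e t : ℝ) : EReal)) atTop (nhds ((-0 : ℝ) : EReal)) :=
      (continuous_coe_real_ereal.tendsto _).comp he.neg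
    simpa using h2.liminf_eq
  calc (M : EReal) * liminf (fun t => (a t : EReal)) atTop
      = liminf (fun t => (M : EReal) * (a t : EReal)) atTop +
          liminf (fun t => ((-e t : ℝ) : EReal)) atTop := by
        rw [h1, add_zero, EReal.liminf_const_mul_of_nonneg_of_ne_top (by exact_mod_cast hM)
          (EReal.coe_ne_top M)]
    _ ≤ liminf ((fun t => (M : EReal) * (a t : EReal)) + fun t => ((-e t : ℝ) : EReal)) atTop :=
        EReal.le_liminf_add
    _ ≤ liminf (fun t => (b t : EReal)) atTop := by
        refine liminf_le_liminf (Eventually.of_forall fun t => ?_)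
        simp only [Pi.add_apply]
        rw [← EReal.coe_mul, ← EReal.coe_add, EReal.coe_le_coe_iff]
        linarith [h t]

end LSSTR

end

theorem mainTheorem3 {n : ℕ} (hn : 2 ≤ n) (f : Fin n → ℝ → ℝ) (hf : ∀ j, Measurable (f j))
    (E : Set ℝ) (hE : IsOpen E) (hfE : ∀ j, ContDiffOn ℝ n (f j) E)
    (hA3 : LinearIndependent ℝ (fun (j : Fin n) (x : E) => f j x))
    (σ : ℝ) (hσ : 0 < σ) :
    ∃ M : ℝ, 0 < M ∧
      ∀ (Ω : Type*) [MeasurableSpace Ω] (μ : Measure Ω) [IsProbabilityMeasure μ]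
        (w : ℕ → Ω → ℝ) (θ₀ : EuclideanSpace ℝ (Fin n)) (θ : Ω → EuclideanSpace ℝ (Fin n))
        (y₀ : Ω → ℝ),
        (∀ t, Measurable (w t)) → Measurable θ → Measurable y₀ →
        iIndepFun (fun t => w (t + 1)) μ →
        (∀ t, HasLaw (w (t + 1)) (gaussianReal 0 (σ ^ 2).toNNReal) μ) →
        HasLaw θ (multivariateGaussian θ₀ 1) μ →
        IndepFun θ (fun ω t => w (t + 1) ω) μ →
        IndepFun y₀ (fun ω => (θ ω, fun t => w (t + 1) ω)) μ →
        ∀ᵐ ω ∂μ,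
          (M : EReal) * liminf (fun t : ℕ =>
              (((1 / t : ℝ) * ∑ i ∈ Finset.Icc 1 t,
                1 / LSSTR.condSD μ (fun k ω' => (LSSTR.closedLoop f σ θ₀ θ y₀ w k ω').y)
                  (i - 1) ω : ℝ) : EReal)) atTop
            ≤ liminf (fun t : ℕ =>
              ((LSSTR.lambdaMin (LSSTR.closedLoop f σ θ₀ θ y₀ w (t + 1) ω).P⁻¹ / t : ℝ) :
                EReal)) atTop := by
  open LSSTR in
  have hn0 : 0 < n := by omega
  obtain ⟨c, hc, hcoer⟩ := exists_coercivity_const hn0 hf hE (fun j => (hfE j).continuousOn) hA3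
    (v := (σ ^ 2).toNNReal) (by simpa using hσ.ne')
  refine ⟨c / σ, by positivity, ?_⟩
  intro Ω _ μ _ w θ₀ θ y₀ hw hθ hy hiw hlw hlθ hiθ hiy
  have hdata : ClosedLoopData μ σ w θ₀ θ y₀ := ⟨hw, hθ, hy, hiw, hlw, hlθ, hiθ, hiy⟩
  have hsd := ae_all_iff.2 fun t => hdata.condSD_eq hf hσ t
  have hlln := ae_all_iff.2 fun j => ae_all_iff.2 fun k =>
    hdata.tendsto_average hf hσ (measurable_normGram hf j k) (abs_normGram_le j k)
  filter_upwards [hsd, hlln] with ω hsdω hω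
  have he := (tendsto_finsetSum (Finset.univ : Finset (Fin n)) fun j _ =>
    tendsto_finsetSum (Finset.univ : Finset (Fin n)) fun k _ => (hω j k).abs).const_mul (σ ^ 2)⁻¹
  simp only [abs_zero, Finset.sum_const_zero, mul_zero] at he
  refine mul_liminf_le_liminf (by positivity) he fun t => ?_
  have hIcc : ∑ i ∈ Finset.Icc 1 t, 1 / condSD μ
      (fun k ω' => (closedLoop f σ θ₀ θ y₀ w k ω').y) (i - 1) ω =
      ∑ i ∈ Finset.range t, 1 / √(predVar f σ θ₀ i (outputs f σ θ₀ θ y₀ w i ω)) := by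
    simp only [hsdω]
    rw [Finset.range_eq_Ico, ← Finset.Ico_add_one_right_eq_Icc]
    exact (Finset.sum_Ico_add' (fun i => 1 / √(predVar f σ θ₀ (i - 1)
      (outputs f σ θ₀ θ y₀ w (i - 1) ω))) 0 t 1).symm
  have hb := le_lambdaMin_closedLoop (θ₀ := θ₀) (θ := θ) (y₀ := y₀) (w := w) hn0 hσ hf hcoer
    (fun i => hdata.sq_le_predVar hf hσ i (outputs f σ θ₀ θ y₀ w i ω)) t ω
  rw [hIcc]
  have ht : (0 : ℝ) ≤ t := Nat.cast_nonneg t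
  refine le_trans (le_of_eq ?_) (div_le_div_of_nonneg_right hb ht)
  simp only [abs_div, Nat.abs_cast, ← Finset.sum_div]
  ring
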